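/- Throughout, the space domain is $(-1,1)$. There are absolute constants $\alpha,C_1,C_2>0$ (in particular independent of $\varepsilon$) with the following property. Let $m_0>0$, $\phi_0(1)=-\phi_0(-1)>0$, $\varepsilon>0$ and $0<\gamma_\varepsilon\le\gamma_{max}<\infty$. Let $\psi$ be the solution of the charge-conserving Poisson–Boltzmann equation $$\varepsilon\psi_{xx}=n^0-p^0\ \text{ in }(-1,1),\qquad n^0=\frac{m_0e^{\psi}}{\int_{-1}^1e^{\psi}dx},\quad p^0=\frac{m_0e^{-\psi}}{\int_{-1}^1e^{-\psi}dx},\qquad \psi(\pm1)\pm\gamma_\varepsilon\psi_x(\pm1)=\phi_0(\pm1),$$ and put $\delta^0=n^0-p^0$, $\eta^0=n^0+p^0$. Let $(\tilde\delta,\tilde\eta,\tilde\phi)$ be a classical solution, for $x\in(-1,1)$ and $t>0$, of the linearized problem $$\tilde\delta_t=\tilde\delta_{xx}-(\eta^0\tilde\phi_x)_x-(\tilde\eta\psi_x)_x,\qquad \tilde\eta_t=\tilde\eta_{xx}-(\delta^0\tilde\phi_x)_x-(\tilde\delta\psi_x)_x,\qquad \varepsilon\tilde\phi_{xx}=\tilde\delta,$$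 with the boundary conditions, at $x=\pm1$, $$\tilde\delta_x-\eta^0\tilde\phi_x-\tilde\eta\psi_x=0,\qquad \tilde\eta_x-\delta^0\tilde\phi_x-\tilde\delta\psi_x=0,\qquad \tilde\phi\pm\gamma_\varepsilon\tilde\phi_x=0,$$ and with integrable initial data, attained in $L^1(-1,1)$ as $t\to0^+$, such that $\int_{-1}^1\tilde\delta(x,0)\,dx=\int_{-1}^1\tilde\eta(x,0)\,dx=0$. Assume $$\frac{\gamma_\varepsilon}{\sqrt\varepsilon}>\frac{\left((1+2\gamma_{max})^2+3\right)K_0\,\phi_0(1)}{4M},\qquad M=\sqrt{\frac{m_0}{2e^{\phi_0(1)}}},\qquad K_0=\sup_{0<|y|\le\phi_0(1)}\frac{|e^y-1|}{|y|}.$$ Let $D(x,t)=\int_{-1}^x\tilde\delta(s,t)\,ds$, $H(x,t)=\int_{-1}^x\tilde\eta(s,t)\,ds$, $d=\frac12\int_{-1}^1D\,dx$, $h=\frac12\int_{-1}^1H\,dx$, $\bar D=D-d$, $\bar H=H-h$, $\tilde n=\frac12(\tilde\delta+\tilde\eta)$, $\tilde p=\frac12(\tilde\eta-\tilde\delta)$,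 and $$I_0=\Big[\tfrac12\int_{-1}^1(\bar D^2+\bar H^2)\,dx+d^2+h^2\Big]_{t=0}.$$ Then, for all $t>0$, $$\frac12\int_{-1}^1(\bar D^2+\bar H^2)\,dx+d^2+h^2\le I_0e^{-\alpha t},\qquad \|D\|_{L^2}^2+\|H\|_{L^2}^2\le 2I_0e^{-\alpha t},\qquad \|\tilde n\|_{H^{-1}}^2+\|\tilde p\|_{H^{-1}}^2\le I_0e^{-\alpha t},$$ and, for all $t\ge0$, $$C_1\big(\|D\|_{L^2}+\|H\|_{L^2}\big)\le\|\tilde n\|_{H^{-1}}+\|\tilde p\|_{H^{-1}}\le C_2\big(\|D\|_{L^2}+\|H\|_{L^2}\big),$$ where $\|f\|_{H^{-1}}=\sup\{\int_{-1}^1fv\,dx:\ v\in H^1(-1,1),\ \|v\|_{L^2}^2+\|v_x\|_{L^2}^2=1\}$. -/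

import Mathlib

open Set Filter Topology MeasureTheory

noncomputable section

namespace PNP

/-! Space is the interval `(-1, 1)`. A space-time function `u : ℝ → ℝ → ℝ` is written with the
time first, so that `u t` is the spatial profile at time `t` and `u t x` its value at `x`. -/

/-- Spatial derivative on `[-1, 1]`: the usual derivative in the interior, the one-sided
derivative at `±1`. -/
def dx (f : ℝ → ℝ) : ℝ → ℝ := derivWithin f (Icc (-1) 1)

/-- `m₀ e^ψ / ∫ e^ψ`. -/
def nSteady (m₀ : ℝ) (ψ : ℝ → ℝ) (x : ℝ) : ℝ :=
  m₀ * Real.exp (ψ x) / ∫ y in (-1 : ℝ)..1, Real.exp (ψ y)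

/-- `m₀ e^{-ψ} / ∫ e^{-ψ}`. -/
def pSteady (m₀ : ℝ) (ψ : ℝ → ℝ) (x : ℝ) : ℝ :=
  m₀ * Real.exp (-ψ x) / ∫ y in (-1 : ℝ)..1, Real.exp (-ψ y)

/-- `δ⁰ = n⁰ - p⁰`. -/
def deltaSteady (m₀ : ℝ) (ψ : ℝ → ℝ) (x : ℝ) : ℝ := nSteady m₀ ψ x - pSteady m₀ ψ x

/-- `η⁰ = n⁰ + p⁰`. -/
def etaSteady (m₀ : ℝ) (ψ : ℝ → ℝ) (x : ℝ) : ℝ := nSteady m₀ ψ x + pSteady m₀ ψ x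

/-- `f ∈ C¹([-1, 1]) ∩ C²((-1, 1))`. -/
def IsC1C2 (f : ℝ → ℝ) : Prop :=
  ContDiffOn ℝ 1 f (Icc (-1) 1) ∧ ContDiffOn ℝ 2 f (Ioo (-1) 1)

/-- `ψ` solves the charge-conserving Poisson–Boltzmann equation with Robin boundary data
`φ₀(1) = φb`, `φ₀(-1) = -φb`. -/
structure IsBoundaryLayer (ε γ m₀ φb : ℝ) (ψ : ℝ → ℝ) : Prop where
  regular : IsC1C2 ψ
  poisson : ∀ x ∈ Ioo (-1 : ℝ) 1, ε * dx (dx ψ) x = nSteady m₀ ψ x - pSteady m₀ ψ x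
  robin_right : ψ 1 + γ * dx ψ 1 = φb
  robin_left : ψ (-1) - γ * dx ψ (-1) = -φb

/-- Regularity of a classical solution of a parabolic equation with a flux boundary condition:
`u, u_x` are continuous on `(0, ∞) × [-1, 1]`, and `u_xx, u_t` are continuous on
`(0, ∞) × (-1, 1)`. -/
structure IsParabolicRegular (u : ℝ → ℝ → ℝ) : Prop where
  cont : ContinuousOn (fun q : ℝ × ℝ => u q.1 q.2) (Ioi 0 ×ˢ Icc (-1) 1)
  diff_x : ∀ t > 0, DifferentiableOn ℝ (u t) (Icc (-1) 1)
  cont_x : ContinuousOn (fun q : ℝ × ℝ => dx (u q.1) q.2) (Ioi 0 ×ˢ Icc (-1) 1)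
  diff_xx : ∀ t > 0, DifferentiableOn ℝ (dx (u t)) (Ioo (-1) 1)
  cont_xx : ContinuousOn (fun q : ℝ × ℝ => dx (dx (u q.1)) q.2) (Ioi 0 ×ˢ Ioo (-1) 1)
  diff_t : ∀ x ∈ Ioo (-1 : ℝ) 1, DifferentiableOn ℝ (fun t => u t x) (Ioi 0)
  cont_t : ContinuousOn (fun q : ℝ × ℝ => deriv (fun t => u t q.2) q.1) (Ioi 0 ×ˢ Ioo (-1) 1)

/-- The initial datum `u 0` is integrable on `(-1, 1)` and is attained in `L¹(-1, 1)`. -/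
def AttainsInitialData (u : ℝ → ℝ → ℝ) : Prop :=
  IntervalIntegrable (u 0) volume (-1) 1 ∧
    Tendsto (fun t => ∫ x in (-1 : ℝ)..1, |u t x - u 0 x|) (𝓝[>] 0) (𝓝 0)

/-- `(δ, η, φ)` is a classical solution of the linearized perturbation problem around the
boundary layer `ψ`, with no-flux conditions for `δ, η` and a Robin condition for `φ`. -/
structure IsLinearizedSolution (ε γ m₀ : ℝ) (ψ : ℝ → ℝ) (δ η φ : ℝ → ℝ → ℝ) : Prop where
  regular_delta : IsParabolicRegular δ
  regular_eta : IsParabolicRegular η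
  regular_phi : ∀ t > 0, IsC1C2 (φ t)
  initial_delta : AttainsInitialData δ
  initial_eta : AttainsInitialData η
  eq_delta : ∀ t > 0, ∀ x ∈ Ioo (-1 : ℝ) 1,
    deriv (fun s => δ s x) t = dx (dx (δ t)) x
      - dx (fun y => etaSteady m₀ ψ y * dx (φ t) y) x - dx (fun y => η t y * dx ψ y) x
  eq_eta : ∀ t > 0, ∀ x ∈ Ioo (-1 : ℝ) 1,
    deriv (fun s => η s x) t = dx (dx (η t)) x
      - dx (fun y => deltaSteady m₀ ψ y * dx (φ t) y) x - dx (fun y => δ t y * dx ψ y) x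
  eq_phi : ∀ t > 0, ∀ x ∈ Ioo (-1 : ℝ) 1, ε * dx (dx (φ t)) x = δ t x
  noflux_delta : ∀ t > 0, ∀ x ∈ ({-1, 1} : Set ℝ),
    dx (δ t) x - etaSteady m₀ ψ x * dx (φ t) x - η t x * dx ψ x = 0
  noflux_eta : ∀ t > 0, ∀ x ∈ ({-1, 1} : Set ℝ),
    dx (η t) x - deltaSteady m₀ ψ x * dx (φ t) x - δ t x * dx ψ x = 0
  robin_right : ∀ t > 0, φ t 1 + γ * dx (φ t) 1 = 0
  robin_left : ∀ t > 0, φ t (-1) - γ * dx (φ t) (-1) = 0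

/-- `x ↦ ∫_{-1}^x u(s, t) ds`; this is `D` for `u = δ` and `H` for `u = η`. -/
def prim (u : ℝ → ℝ → ℝ) (t x : ℝ) : ℝ := ∫ s in (-1 : ℝ)..x, u t s

/-- Mean value on `(-1, 1)`; `d(t)` and `h(t)` are the means of `D` and `H`. -/
def mean (f : ℝ → ℝ) : ℝ := (1 / 2) * ∫ x in (-1 : ℝ)..1, f x

/-- `f - mean f`; `D̄` and `H̄` are obtained so from `D` and `H`. -/
def fluct (f : ℝ → ℝ) (x : ℝ) : ℝ := f x - mean f

/-- `½ ∫ (D̄² + H̄²) dx + d² + h²` at time `t`. -/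
def energy (δ η : ℝ → ℝ → ℝ) (t : ℝ) : ℝ :=
  (1 / 2) * (∫ x in (-1 : ℝ)..1, ((fluct (prim δ t) x) ^ 2 + (fluct (prim η t) x) ^ 2))
    + (mean (prim δ t)) ^ 2 + (mean (prim η t)) ^ 2

/-- `L²(-1, 1)` norm. -/
def l2Norm (f : ℝ → ℝ) : ℝ := Real.sqrt (∫ x in (-1 : ℝ)..1, (f x) ^ 2)

/-- `v ∈ H¹(-1, 1)` with weak derivative `w`. -/
structure IsH1 (v w : ℝ → ℝ) : Prop where
  memLp : MemLp v 2 (volume.restrict (Ioo (-1) 1))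
  memLp_deriv : MemLp w 2 (volume.restrict (Ioo (-1) 1))
  weak : ∀ ζ : ℝ → ℝ, ContDiff ℝ ((⊤ : ℕ∞) : WithTop ℕ∞) ζ → HasCompactSupport ζ →
    tsupport ζ ⊆ Ioo (-1) 1 →
    ∫ x in (-1 : ℝ)..1, v x * deriv ζ x = - ∫ x in (-1 : ℝ)..1, w x * ζ x

/-- Norm in the dual of `H¹(-1, 1)`: the supremum of `∫ f v` over `v ∈ H¹(-1, 1)` with
`‖v‖_{L²}² + ‖v_x‖_{L²}² = 1`. -/
def hMinusOneNorm (f : ℝ → ℝ) : ℝ :=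
  sSup {r : ℝ | ∃ v w : ℝ → ℝ, IsH1 v w ∧ (l2Norm v) ^ 2 + (l2Norm w) ^ 2 = 1 ∧
    r = ∫ x in (-1 : ℝ)..1, f x * v x}

/-- `ñ = (δ + η) / 2` at time `t`. -/
def nTilde (δ η : ℝ → ℝ → ℝ) (t x : ℝ) : ℝ := (δ t x + η t x) / 2

/-- `p̃ = (η - δ) / 2` at time `t`. -/
def pTilde (δ η : ℝ → ℝ → ℝ) (t x : ℝ) : ℝ := (η t x - δ t x) / 2

/-- `M = √(m₀ / (2 e^{φ₀(1)}))`. -/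
def constM (m₀ φb : ℝ) : ℝ := Real.sqrt (m₀ / (2 * Real.exp φb))

/-- `K₀ = sup_{0 < |y| ≤ φ₀(1)} |e^y - 1| / |y|`. -/
def constK (φb : ℝ) : ℝ :=
  sSup ((fun y : ℝ => |Real.exp y - 1| / |y|) '' {y : ℝ | 0 < |y| ∧ |y| ≤ φb})

end PNP

end

noncomputable section

namespace PNP

/-! ### Calculus on `[-1, 1]` -/

/-! Integrating the two transport equations from `-1` turns them into `D_t = F_δ`, `H_t = F_η`, with
fluxes that vanish at both ends, so `D` and `H` stay zero at `±1`. The energy is just `½ ∫ (D² +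
H²)` (`energy_eq`), and the Poisson equation with its Robin condition gives `φ_x = (D - k) / ε` with
`k = d / (1 + γ)` (`dx_phi_eq`).

In `E' = ∫ (D F_δ + H F_η)` the cross terms with `ψ_x` and `δ⁰ = ε ψ_xx` combine with `D δ_x + H
η_x` into an exact derivative, leaving `-∫ δ² - ∫ η² - ε⁻¹ ∫ η⁰ D (D - k) - k ∫ η ψ_x`. Only the
terms carrying `k` can be harmful. The first integral of Poisson–Boltzmann gives `κ ≤ η⁰ ≤ κ + ε
ψ_x² / 2` with `κ ≥ 2 M²` (`exists_etaSteady_bounds`). The constant part `κ` yields a gain `2 κ γ (1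
+ γ) k² / ε`, while all losses are at most `½ ∫ η² + ⅝ k² ∫ ψ_x²`. Since `∫ ψ_x² ≤ φ₀(1)² / (2γ)`
(`integral_sq_dx_le`), the condition on `γ / √ε` lets the gain win, so `E' ≤ -∫ δ² - ½ ∫ η²`
(`integral_production_le`). The Poincaré inequality and Grönwall's argument then give decay at rate
`1/4`.

For the dual norms, a mean-zero `f` with primitive `P` satisfies `∫ f v = -∫ P v_x`
(`integral_mul_eq_of_isH1`). Cauchy–Schwarz bounds its dual norm by the `L²` norm of `P`, and
testing with a multiple of the primitive of `P` gives the converse (`hMinusOneNorm_le`,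
`l2Norm_primitive_le`). -/

theorem hasDerivAt_dx {f : ℝ → ℝ} (hf : DifferentiableOn ℝ f (Icc (-1) 1)) {x : ℝ}
    (hx : x ∈ Ioo (-1 : ℝ) 1) : HasDerivAt f (dx f x) x :=
  (hf x (Ioo_subset_Icc_self hx)).hasDerivWithinAt.hasDerivAt (Icc_mem_nhds hx.1 hx.2)

theorem dx_eq_of_hasDerivAt {f : ℝ → ℝ} {f' x : ℝ} (hx : x ∈ Ioo (-1 : ℝ) 1)
    (hf : HasDerivAt f f' x) : dx f x = f' := by
  rw [dx, derivWithin_of_mem_nhds (Icc_mem_nhds hx.1 hx.2), hf.deriv]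

theorem hasDerivAt_dx_of_Ioo {f : ℝ → ℝ} (hf : DifferentiableOn ℝ f (Ioo (-1) 1)) {x : ℝ}
    (hx : x ∈ Ioo (-1 : ℝ) 1) : HasDerivAt f (dx f x) x := by
  have h := (hf x hx).hasDerivWithinAt.hasDerivAt (Ioo_mem_nhds hx.1 hx.2)
  rwa [← dx_eq_of_hasDerivAt hx h] at h

theorem IsC1C2.differentiableOn {f : ℝ → ℝ} (hf : IsC1C2 f) :
    DifferentiableOn ℝ f (Icc (-1) 1) := hf.1.differentiableOn (by simp)

theorem IsC1C2.continuousOn {f : ℝ → ℝ} (hf : IsC1C2 f) :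
    ContinuousOn f (Icc (-1) 1) := hf.1.continuousOn

theorem IsC1C2.continuousOn_dx {f : ℝ → ℝ} (hf : IsC1C2 f) :
    ContinuousOn (dx f) (Icc (-1) 1) :=
  hf.1.continuousOn_derivWithin (uniqueDiffOn_Icc (by norm_num)) le_rfl

theorem IsC1C2.differentiableOn_dx {f : ℝ → ℝ} (hf : IsC1C2 f) :
    DifferentiableOn ℝ (dx f) (Ioo (-1) 1) := by
  have h := hf.2.derivWithin (m := 1) (uniqueDiffOn_Ioo (-1 : ℝ) 1) (by norm_num)
  refine (h.differentiableOn (by simp)).congr fun x hx => ?_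
  rw [dx, derivWithin_of_mem_nhds (Icc_mem_nhds hx.1 hx.2),
    derivWithin_of_mem_nhds (Ioo_mem_nhds hx.1 hx.2)]

theorem intervalIntegrable_of_continuousOn {f : ℝ → ℝ} (hf : ContinuousOn f (Icc (-1) 1)) :
    IntervalIntegrable f volume (-1) 1 :=
  ContinuousOn.intervalIntegrable (by rwa [uIcc_of_le (by norm_num)])

theorem integral_eq_sub_of_Ioo {f f' : ℝ → ℝ} (hf : ContinuousOn f (Icc (-1) 1))
    (hd : ∀ x ∈ Ioo (-1 : ℝ) 1, HasDerivAt f (f' x) x) (hf' : ContinuousOn f' (Icc (-1) 1)) :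
    ∫ x in (-1 : ℝ)..1, f' x = f 1 - f (-1) :=
  intervalIntegral.integral_eq_sub_of_hasDerivAt_of_le (by norm_num) hf hd
    (intervalIntegrable_of_continuousOn hf')

theorem eq_of_hasDerivAt_zero {f : ℝ → ℝ} (hf : ContinuousOn f (Icc (-1) 1))
    (hd : ∀ x ∈ Ioo (-1 : ℝ) 1, HasDerivAt f 0 x) {x y : ℝ} (hx : x ∈ Icc (-1 : ℝ) 1)
    (hy : y ∈ Icc (-1 : ℝ) 1) : f x = f y := by
  have hd' : ∀ x ∈ interior (Icc (-1 : ℝ) 1),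
      HasDerivWithinAt f 0 (interior (Icc (-1 : ℝ) 1)) x := fun x hx =>
    (hd x (by rwa [interior_Icc] at hx)).hasDerivWithinAt
  have hmono := monotoneOn_of_hasDerivWithinAt_nonneg (convex_Icc (-1 : ℝ) 1) hf hd' (by simp)
  have hanti := antitoneOn_of_hasDerivWithinAt_nonpos (convex_Icc (-1 : ℝ) 1) hf hd' (by simp)
  rcases le_total x y with hxy | hxy
  · exact le_antisymm (hmono hx hy hxy) (hanti hx hy hxy)
  · exact le_antisymm (hanti hy hx hxy) (hmono hy hx hxy)

theorem integral_mul_deriv_of_Ioo {u v u' v' : ℝ → ℝ} (hu : ContinuousOn u (Icc (-1) 1))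
    (hv : ContinuousOn v (Icc (-1) 1)) (hu' : ContinuousOn u' (Icc (-1) 1))
    (hv' : ContinuousOn v' (Icc (-1) 1)) (hdu : ∀ x ∈ Ioo (-1 : ℝ) 1, HasDerivAt u (u' x) x)
    (hdv : ∀ x ∈ Ioo (-1 : ℝ) 1, HasDerivAt v (v' x) x) :
    ∫ x in (-1 : ℝ)..1, u x * v' x
      = u 1 * v 1 - u (-1) * v (-1) - ∫ x in (-1 : ℝ)..1, u' x * v x := by
  have h : (-1 : ℝ) ≤ 1 := by norm_num
  apply intervalIntegral.integral_mul_deriv_eq_deriv_mul_of_hasDerivAt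
  all_goals first
    | rwa [uIcc_of_le h]
    | rwa [min_eq_left h, max_eq_right h]
    | exact intervalIntegrable_of_continuousOn ‹_›

theorem continuousOn_primitive {f : ℝ → ℝ} (hf : IntervalIntegrable f volume (-1) 1) :
    ContinuousOn (fun x => ∫ s in (-1 : ℝ)..x, f s) (Icc (-1) 1) := by
  have h := intervalIntegral.continuousOn_primitive_interval (μ := volume) (f := f) (a := -1)
    (b := 1) ((intervalIntegrable_iff' (by simp)).1 hf)
  rwa [uIcc_of_le (by norm_num)] at h

theorem hasDerivAt_primitive {f : ℝ → ℝ} (hf : ContinuousOn f (Icc (-1) 1)) {x : ℝ}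
    (hx : x ∈ Ioo (-1 : ℝ) 1) : HasDerivAt (fun x => ∫ s in (-1 : ℝ)..x, f s) (f x) x := by
  have hi : IntervalIntegrable f volume (-1) x :=
    (intervalIntegrable_of_continuousOn hf).mono_set (by
      rw [uIcc_of_le hx.1.le, uIcc_of_le (by norm_num)]; exact Icc_subset_Icc_right hx.2.le)
  exact intervalIntegral.integral_hasDerivAt_right hi
    ((hf.mono Ioo_subset_Icc_self).stronglyMeasurableAtFilter isOpen_Ioo x hx)
    (hf.continuousAt (Icc_mem_nhds hx.1 hx.2))

/-- Integration by parts for the primitives of two integrable functions. -/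
theorem integral_mul_primitive {f g : ℝ → ℝ} (hf : IntervalIntegrable f volume (-1) 1)
    (hg : IntervalIntegrable g volume (-1) 1) :
    ∫ x in (-1 : ℝ)..1, f x * ∫ s in (-1 : ℝ)..x, g s
      = (∫ x in (-1 : ℝ)..1, f x) * (∫ x in (-1 : ℝ)..1, g x)
        - ∫ x in (-1 : ℝ)..1, (∫ s in (-1 : ℝ)..x, f s) * g x := by
  have hF := hf.absolutelyContinuousOnInterval_intervalIntegral (c := -1) (by simp)
  have hG := hg.absolutelyContinuousOnInterval_intervalIntegral (c := -1) (by simp)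
  have key := hF.integral_mul_deriv_eq_deriv_mul hG
  have h1 : ∫ x in (-1 : ℝ)..1, (∫ s in (-1 : ℝ)..x, f s)
        * deriv (fun x => ∫ s in (-1 : ℝ)..x, g s) x
      = ∫ x in (-1 : ℝ)..1, (∫ s in (-1 : ℝ)..x, f s) * g x := by
    apply intervalIntegral.integral_congr_ae
    filter_upwards [hg.ae_hasDerivAt_integral] with x hx hx'
    rw [(hx (uIoc_subset_uIcc hx') (-1) (by simp)).deriv]
  have h2 : ∫ x in (-1 : ℝ)..1, deriv (fun x => ∫ s in (-1 : ℝ)..x, f s) x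
        * (∫ s in (-1 : ℝ)..x, g s)
      = ∫ x in (-1 : ℝ)..1, f x * ∫ s in (-1 : ℝ)..x, g s := by
    apply intervalIntegral.integral_congr_ae
    filter_upwards [hf.ae_hasDerivAt_integral] with x hx hx'
    rw [(hx (uIoc_subset_uIcc hx') (-1) (by simp)).deriv]
  rw [h1, h2] at key
  simp only [intervalIntegral.integral_same, mul_zero, sub_zero] at key
  linarith

/-! ### The Cauchy–Schwarz inequality -/

/-- The quadratic `s ↦ ∫ (s f + g)²` is nonnegative, so its discriminant is not positive. -/
theorem sq_integral_mul_le {f g : ℝ → ℝ} {a b : ℝ} (hab : a ≤ b)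
    (hf : IntervalIntegrable (fun x => f x ^ 2) volume a b)
    (hg : IntervalIntegrable (fun x => g x ^ 2) volume a b)
    (hfg : IntervalIntegrable (fun x => f x * g x) volume a b) :
    (∫ x in a..b, f x * g x) ^ 2 ≤ (∫ x in a..b, f x ^ 2) * ∫ x in a..b, g x ^ 2 := by
  have h : ∀ s : ℝ, 0 ≤ (∫ x in a..b, f x ^ 2) * (s * s) + (2 * ∫ x in a..b, f x * g x) * s
      + ∫ x in a..b, g x ^ 2 := by
    intro s
    have h0 : 0 ≤ ∫ x in a..b, (s * f x + g x) ^ 2 :=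
      intervalIntegral.integral_nonneg hab fun x _ => sq_nonneg _
    have h1 : ∫ x in a..b, (s * f x + g x) ^ 2
        = ∫ x in a..b, (s * s * f x ^ 2 + 2 * s * (f x * g x) + g x ^ 2) := by
      congr 1; ext x; ring
    rw [h1, intervalIntegral.integral_add ((hf.const_mul _).add (hfg.const_mul _)) hg,
      intervalIntegral.integral_add (hf.const_mul _) (hfg.const_mul _),
      intervalIntegral.integral_const_mul, intervalIntegral.integral_const_mul] at h0
    linarith
  have := discrim_le_zero h
  rw [discrim] at this
  linarith

theorem l2Norm_nonneg (f : ℝ → ℝ) : 0 ≤ l2Norm f := Real.sqrt_nonneg _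

theorem l2Norm_sq (f : ℝ → ℝ) : l2Norm f ^ 2 = ∫ x in (-1 : ℝ)..1, f x ^ 2 :=
  Real.sq_sqrt (intervalIntegral.integral_nonneg (by norm_num) fun x _ => sq_nonneg _)

theorem abs_integral_mul_le_l2Norm {f g : ℝ → ℝ}
    (hf : IntervalIntegrable (fun x => f x ^ 2) volume (-1) 1)
    (hg : IntervalIntegrable (fun x => g x ^ 2) volume (-1) 1)
    (hfg : IntervalIntegrable (fun x => f x * g x) volume (-1) 1) :
    |∫ x in (-1 : ℝ)..1, f x * g x| ≤ l2Norm f * l2Norm g := by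
  apply abs_le_of_sq_le_sq _ (mul_nonneg (l2Norm_nonneg _) (l2Norm_nonneg _))
  rw [mul_pow, l2Norm_sq, l2Norm_sq]
  exact sq_integral_mul_le (by norm_num) hf hg hfg

/-- Poincaré inequality for a primitive. -/
theorem integral_sq_primitive_le {f : ℝ → ℝ} (hf : ContinuousOn f (Icc (-1) 1)) :
    ∫ x in (-1 : ℝ)..1, (∫ s in (-1 : ℝ)..x, f s) ^ 2 ≤ 4 * ∫ x in (-1 : ℝ)..1, f x ^ 2 := by
  -- Cauchy–Schwarz against `1` gives the factor `x + 1 ≤ 2`; integrating over an interval of length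
  -- `2` gives the constant `4`.
  have hb : ∀ x ∈ Icc (-1 : ℝ) 1,
      (∫ s in (-1 : ℝ)..x, f s) ^ 2 ≤ 2 * ∫ x in (-1 : ℝ)..1, f x ^ 2 := by
    intro x hx
    have hsub : uIcc (-1) x ⊆ uIcc (-1 : ℝ) 1 := by
      rw [uIcc_of_le hx.1, uIcc_of_le (by norm_num)]; exact Icc_subset_Icc_right hx.2
    have i1 := (intervalIntegrable_of_continuousOn hf).mono_set hsub
    have i2 := (intervalIntegrable_of_continuousOn (hf.pow 2)).mono_set hsub
    have := sq_integral_mul_le (f := f) (g := fun _ => 1) hx.1 i2 (by simp)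
      (by simpa using i1)
    simp only [mul_one, one_pow, intervalIntegral.integral_const, smul_eq_mul] at this
    have h2 : ∫ s in (-1 : ℝ)..x, f s ^ 2 ≤ ∫ x in (-1 : ℝ)..1, f x ^ 2 :=
      intervalIntegral.integral_mono_interval le_rfl hx.1 hx.2
        (Eventually.of_forall fun x => sq_nonneg _) (intervalIntegrable_of_continuousOn (hf.pow 2))
    have h3 : 0 ≤ ∫ s in (-1 : ℝ)..x, f s ^ 2 :=
      intervalIntegral.integral_nonneg hx.1 fun x _ => sq_nonneg _
    nlinarith [hx.1, hx.2]
  calc _ ≤ ∫ _ in (-1 : ℝ)..1, 2 * ∫ x in (-1 : ℝ)..1, f x ^ 2 :=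
        intervalIntegral.integral_mono_on (by norm_num)
          (intervalIntegrable_of_continuousOn
            ((continuousOn_primitive (intervalIntegrable_of_continuousOn hf)).pow 2))
          (by simp) hb
    _ = _ := by rw [intervalIntegral.integral_const]; simp; ring


/-! ### The boundary layer -/

section Steady

variable {m₀ : ℝ} {ψ : ℝ → ℝ}

theorem integral_exp_pos (hψ : ContinuousOn ψ (Icc (-1) 1)) :
    0 < ∫ y in (-1 : ℝ)..1, Real.exp (ψ y) :=
  intervalIntegral.intervalIntegral_pos_of_pos_on
    (intervalIntegrable_of_continuousOn (Real.continuous_exp.comp_continuousOn hψ))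
    (fun _ _ => Real.exp_pos _) (by norm_num)

theorem pSteady_eq_nSteady_neg : pSteady m₀ ψ = nSteady m₀ (fun x => -ψ x) := rfl

theorem continuousOn_nSteady (hψ : ContinuousOn ψ (Icc (-1) 1)) :
    ContinuousOn (nSteady m₀ ψ) (Icc (-1) 1) :=
  ((Real.continuous_exp.comp_continuousOn hψ).const_smul m₀).div_const _

theorem continuousOn_pSteady (hψ : ContinuousOn ψ (Icc (-1) 1)) :
    ContinuousOn (pSteady m₀ ψ) (Icc (-1) 1) := continuousOn_nSteady hψ.fun_neg

theorem continuousOn_deltaSteady (hψ : ContinuousOn ψ (Icc (-1) 1)) :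
    ContinuousOn (deltaSteady m₀ ψ) (Icc (-1) 1) :=
  (continuousOn_nSteady hψ).sub (continuousOn_pSteady hψ)

theorem continuousOn_etaSteady (hψ : ContinuousOn ψ (Icc (-1) 1)) :
    ContinuousOn (etaSteady m₀ ψ) (Icc (-1) 1) :=
  (continuousOn_nSteady hψ).add (continuousOn_pSteady hψ)

theorem hasDerivAt_nSteady {ψ' x : ℝ} (h : HasDerivAt ψ ψ' x) :
    HasDerivAt (nSteady m₀ ψ) (nSteady m₀ ψ x * ψ') x := by
  have := (h.exp.const_mul m₀).div_const (∫ y in (-1 : ℝ)..1, Real.exp (ψ y))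
  refine this.congr_deriv ?_
  rw [nSteady]; ring

theorem hasDerivAt_pSteady {ψ' x : ℝ} (h : HasDerivAt ψ ψ' x) :
    HasDerivAt (pSteady m₀ ψ) (-(pSteady m₀ ψ x * ψ')) x := by
  have := hasDerivAt_nSteady (m₀ := m₀) h.fun_neg
  rw [pSteady_eq_nSteady_neg]
  exact this.congr_deriv (by ring)

theorem hasDerivAt_etaSteady {ψ' x : ℝ} (h : HasDerivAt ψ ψ' x) :
    HasDerivAt (etaSteady m₀ ψ) (deltaSteady m₀ ψ x * ψ') x :=
  ((hasDerivAt_nSteady h).add (hasDerivAt_pSteady h)).congr_deriv (by rw [deltaSteady]; ring)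

theorem hasDerivAt_deltaSteady {ψ' x : ℝ} (h : HasDerivAt ψ ψ' x) :
    HasDerivAt (deltaSteady m₀ ψ) (etaSteady m₀ ψ x * ψ') x :=
  ((hasDerivAt_nSteady h).sub (hasDerivAt_pSteady h)).congr_deriv (by rw [etaSteady]; ring)

theorem integral_nSteady (hψ : ContinuousOn ψ (Icc (-1) 1)) :
    ∫ x in (-1 : ℝ)..1, nSteady m₀ ψ x = m₀ := by
  have h := (integral_exp_pos hψ).ne'
  simp only [nSteady]
  rw [intervalIntegral.integral_div, intervalIntegral.integral_const_mul, mul_div_assoc,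
    div_self h, mul_one]

theorem integral_deltaSteady (hψ : ContinuousOn ψ (Icc (-1) 1)) :
    ∫ x in (-1 : ℝ)..1, deltaSteady m₀ ψ x = 0 := by
  simp only [deltaSteady]
  rw [intervalIntegral.integral_sub
    (intervalIntegrable_of_continuousOn (continuousOn_nSteady hψ))
    (intervalIntegrable_of_continuousOn (continuousOn_pSteady hψ)), integral_nSteady hψ,
    pSteady_eq_nSteady_neg, integral_nSteady hψ.fun_neg, sub_self]

/-- The density `n⁰` is positively correlated with `ψ`. -/
theorem integral_mul_nSteady_ge (hm : 0 < m₀) (hψ : ContinuousOn ψ (Icc (-1) 1)) :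
    m₀ / 2 * (∫ x in (-1 : ℝ)..1, ψ x) ≤ ∫ x in (-1 : ℝ)..1, ψ x * nSteady m₀ ψ x := by
  have hZ := integral_exp_pos hψ
  set Z := ∫ y in (-1 : ℝ)..1, Real.exp (ψ y) with hZd
  -- `e^c` is the mean of `e^ψ`, so integrating `(ψ - c) (e^ψ - e^c) ≥ 0` makes the terms with the
  -- factor `c` cancel.
  set c := Real.log (Z / 2) with hc
  have hec : Real.exp c = Z / 2 := Real.exp_log (by positivity)
  have hpt : ∀ x ∈ Icc (-1 : ℝ) 1,
      0 ≤ ψ x * nSteady m₀ ψ x - m₀ / 2 * ψ x - c * nSteady m₀ ψ x + c * (m₀ / 2) := by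
    intro x _
    have h1 : nSteady m₀ ψ x = m₀ / Z * Real.exp (ψ x) := by rw [nSteady]; ring
    have h2 : m₀ / 2 = m₀ / Z * Real.exp c := by rw [hec]; field_simp
    have h3 : 0 ≤ (ψ x - c) * (Real.exp (ψ x) - Real.exp c) := by
      rcases le_total (ψ x) c with h | h
      · exact mul_nonneg_of_nonpos_of_nonpos (by linarith)
          (by linarith [Real.exp_le_exp.2 h])
      · exact mul_nonneg (by linarith) (by linarith [Real.exp_le_exp.2 h])
    have h4 := mul_nonneg (div_pos hm hZ).le h3
    rw [h1, h2]
    linarith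
  have h := intervalIntegral.integral_nonneg (μ := volume) (by norm_num) hpt
  have hN := continuousOn_nSteady (m₀ := m₀) hψ
  have i1 := intervalIntegrable_of_continuousOn (hψ.fun_mul hN)
  have i2 := (intervalIntegrable_of_continuousOn hψ).const_mul (m₀ / 2)
  have i3 := (intervalIntegrable_of_continuousOn hN).const_mul c
  rw [intervalIntegral.integral_add ((i1.sub i2).sub i3) (by simp),
    intervalIntegral.integral_sub (i1.sub i2) i3, intervalIntegral.integral_sub i1 i2,
    intervalIntegral.integral_const_mul, intervalIntegral.integral_const_mul,
    integral_nSteady hψ, intervalIntegral.integral_const, smul_eq_mul] at h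
  linarith

/-- The correlation inequality is applied to `ψ` and to `-ψ`; the two mean terms cancel. -/
theorem integral_mul_deltaSteady_nonneg (hm : 0 < m₀) (hψ : ContinuousOn ψ (Icc (-1) 1)) :
    0 ≤ ∫ x in (-1 : ℝ)..1, ψ x * deltaSteady m₀ ψ x := by
  have h1 := integral_mul_nSteady_ge hm hψ
  have h2 := integral_mul_nSteady_ge hm hψ.fun_neg
  rw [intervalIntegral.integral_neg, ← pSteady_eq_nSteady_neg] at h2
  have e : ∫ x in (-1 : ℝ)..1, ψ x * deltaSteady m₀ ψ x
      = (∫ x in (-1 : ℝ)..1, ψ x * nSteady m₀ ψ x)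
        + ∫ x in (-1 : ℝ)..1, -ψ x * pSteady m₀ ψ x := by
    rw [← intervalIntegral.integral_add
      (intervalIntegrable_of_continuousOn (hψ.fun_mul (continuousOn_nSteady hψ)))
      (intervalIntegrable_of_continuousOn (hψ.fun_neg.fun_mul (continuousOn_pSteady hψ)))]
    congr 1; ext x; rw [deltaSteady]; ring
  linarith

theorem nSteady_pos (hm : 0 < m₀) (hψ : ContinuousOn ψ (Icc (-1) 1)) (x : ℝ) :
    0 < nSteady m₀ ψ x := div_pos (mul_pos hm (Real.exp_pos _)) (integral_exp_pos hψ)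

theorem etaSteady_pos (hm : 0 < m₀) (hψ : ContinuousOn ψ (Icc (-1) 1)) (x : ℝ) :
    0 < etaSteady m₀ ψ x := add_pos (nSteady_pos hm hψ x) (nSteady_pos hm hψ.fun_neg x)

/-- The product `n⁰ p⁰` is constant in `x`, and `(n + p)² = (n - p)² + 4 n p`. Hence `η⁰` is
smallest where `δ⁰` vanishes. -/
theorem sq_etaSteady (x : ℝ) :
    etaSteady m₀ ψ x ^ 2 = deltaSteady m₀ ψ x ^ 2
      + 4 * m₀ ^ 2 / ((∫ y in (-1 : ℝ)..1, Real.exp (ψ y))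
        * ∫ y in (-1 : ℝ)..1, Real.exp (-ψ y)) := by
  have h : nSteady m₀ ψ x * pSteady m₀ ψ x
      = m₀ ^ 2 / ((∫ y in (-1 : ℝ)..1, Real.exp (ψ y)) * ∫ y in (-1 : ℝ)..1, Real.exp (-ψ y)) := by
    rw [nSteady, pSteady, div_mul_div_comm]
    congr 1
    have : Real.exp (ψ x) * Real.exp (-ψ x) = 1 := by rw [← Real.exp_add]; simp
    linear_combination m₀ ^ 2 * this
  rw [mul_div_assoc, ← h, etaSteady, deltaSteady]; ring

end Steady

/-! ### Slope, monotonicity and density bounds for the boundary layer -/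

namespace IsBoundaryLayer

variable {ε γ m₀ φb : ℝ} {ψ : ℝ → ℝ}

theorem hasDerivAt_dx (h : IsBoundaryLayer ε γ m₀ φb ψ) (hε : 0 < ε) {x : ℝ}
    (hx : x ∈ Ioo (-1 : ℝ) 1) : HasDerivAt (dx ψ) (deltaSteady m₀ ψ x / ε) x := by
  refine (hasDerivAt_dx_of_Ioo h.regular.differentiableOn_dx hx).congr_deriv ?_
  rw [eq_div_iff hε.ne', mul_comm]
  exact h.poisson x hx

theorem dx_right_eq_left (h : IsBoundaryLayer ε γ m₀ φb ψ) (hε : 0 < ε) :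
    dx ψ 1 = dx ψ (-1) := by
  have hc := h.regular.continuousOn
  have := integral_eq_sub_of_Ioo h.regular.continuousOn_dx (fun x hx => h.hasDerivAt_dx hε hx)
    ((continuousOn_deltaSteady hc).div_const ε)
  rw [intervalIntegral.integral_div, integral_deltaSteady hc, zero_div] at this
  linarith

/-- Integration by parts leaves `-∫ ψ ψ_xx = -ε⁻¹ ∫ ψ δ⁰ ≤ 0` and a boundary term. As both end
slopes agree, the latter is the slope times `ψ(1) - ψ(-1)`, which the Robin conditions evaluate. -/
theorem integral_sq_dx_le_slope (h : IsBoundaryLayer ε γ m₀ φb ψ) (hm : 0 < m₀) (hε : 0 < ε) :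
    ∫ x in (-1 : ℝ)..1, dx ψ x ^ 2 ≤ dx ψ 1 * (2 * φb - 2 * γ * dx ψ 1) := by
  have hc := h.regular.continuousOn
  have hs := h.dx_right_eq_left hε
  have := integral_mul_deriv_of_Ioo hc h.regular.continuousOn_dx h.regular.continuousOn_dx
    ((continuousOn_deltaSteady hc).div_const ε)
    (fun x hx => PNP.hasDerivAt_dx h.regular.differentiableOn hx)
    (fun x hx => h.hasDerivAt_dx hε hx)
  have h1 : 0 ≤ ∫ x in (-1 : ℝ)..1, ψ x * (deltaSteady m₀ ψ x / ε) := by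
    simp_rw [← mul_div_assoc]
    rw [intervalIntegral.integral_div]
    exact div_nonneg (integral_mul_deltaSteady_nonneg hm hc) hε.le
  simp_rw [← sq] at this
  have hr := h.robin_right
  have hl := h.robin_left
  rw [← hs] at this hl
  have e : ψ 1 - ψ (-1) = 2 * φb - 2 * γ * dx ψ 1 := by linarith
  rw [← e]
  linarith

/-- The right side is the maximum of the bound in `integral_sq_dx_le_slope` over all slopes, reached
at slope `φb / (2γ)`. -/
theorem integral_sq_dx_le (h : IsBoundaryLayer ε γ m₀ φb ψ) (hm : 0 < m₀) (hε : 0 < ε)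
    (hγ : 0 < γ) : ∫ x in (-1 : ℝ)..1, dx ψ x ^ 2 ≤ φb ^ 2 / (2 * γ) := by
  refine (h.integral_sq_dx_le_slope hm hε).trans ?_
  rw [le_div_iff₀ (by positivity)]
  nlinarith [sq_nonneg (2 * γ * dx ψ 1 - φb)]

theorem dx_right_nonneg (h : IsBoundaryLayer ε γ m₀ φb ψ) (hm : 0 < m₀) (hε : 0 < ε)
    (hγ : 0 < γ) (hφ : 0 < φb) : 0 ≤ dx ψ 1 := by
  have h1 := h.integral_sq_dx_le_slope hm hε
  have h2 : 0 ≤ ∫ x in (-1 : ℝ)..1, dx ψ x ^ 2 :=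
    intervalIntegral.integral_nonneg (by norm_num) fun x _ => sq_nonneg _
  by_contra! hs
  nlinarith [mul_pos hγ (neg_pos.2 hs)]

/-- First integral of the Poisson–Boltzmann equation. -/
theorem first_integral (h : IsBoundaryLayer ε γ m₀ φb ψ) (hε : 0 < ε) {x y : ℝ}
    (hx : x ∈ Icc (-1 : ℝ) 1) (hy : y ∈ Icc (-1 : ℝ) 1) :
    ε / 2 * dx ψ x ^ 2 - etaSteady m₀ ψ x = ε / 2 * dx ψ y ^ 2 - etaSteady m₀ ψ y := by
  have hc : ContinuousOn (fun x => ε / 2 * dx ψ x ^ 2 - etaSteady m₀ ψ x) (Icc (-1) 1) :=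
    (continuousOn_const.mul (h.regular.continuousOn_dx.pow 2)).sub
      (continuousOn_etaSteady h.regular.continuousOn)
  refine eq_of_hasDerivAt_zero hc (fun x hx => ?_) hx hy
  have h1 := (((h.hasDerivAt_dx hε hx).pow 2).const_mul (ε / 2)).sub
    (hasDerivAt_etaSteady (m₀ := m₀) (PNP.hasDerivAt_dx h.regular.differentiableOn hx))
  refine h1.congr_deriv ?_
  simp only [Nat.cast_ofNat, Nat.add_one_sub_one, pow_one]
  field_simp
  ring

theorem etaSteady_le_of_deltaSteady_eq_zero (hm : 0 < m₀) (hψ : ContinuousOn ψ (Icc (-1) 1))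
    {y : ℝ} (hy : deltaSteady m₀ ψ y = 0) (x : ℝ) : etaSteady m₀ ψ y ≤ etaSteady m₀ ψ x := by
  apply le_of_sq_le_sq _ (etaSteady_pos hm hψ x).le
  rw [sq_etaSteady y, sq_etaSteady x, hy]
  nlinarith [sq_nonneg (deltaSteady m₀ ψ x)]

/-- At an interior minimum `y` of `ψ_x` one has `δ⁰ = 0`, so `η⁰` is minimal there. Were `ψ_x(y) <
0`, then `ψ_x` would vanish at some `z` between `y` and `1`, and the first integral would force
`η⁰(z) < η⁰(y)`. -/
theorem dx_nonneg (h : IsBoundaryLayer ε γ m₀ φb ψ) (hm : 0 < m₀) (hε : 0 < ε)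
    (hγ : 0 < γ) (hφ : 0 < φb) {x : ℝ} (hx : x ∈ Icc (-1 : ℝ) 1) : 0 ≤ dx ψ x := by
  have hs := h.dx_right_nonneg hm hε hγ hφ
  obtain ⟨y, hy, hmin⟩ := isCompact_Icc.exists_isMinOn (nonempty_Icc.2 (by norm_num : (-1 : ℝ) ≤ 1))
    h.regular.continuousOn_dx
  refine le_trans ?_ (hmin hx)
  rcases eq_or_lt_of_le hy.1 with h1 | h1
  · rw [← h1, ← h.dx_right_eq_left hε]; exact hs
  rcases eq_or_lt_of_le hy.2 with h2 | h2
  · rw [h2]; exact hs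
  have hd := h.hasDerivAt_dx hε ⟨h1, h2⟩
  have h0 : deltaSteady m₀ ψ y = 0 := by
    have := (hmin.isLocalMin (Icc_mem_nhds h1 h2)).hasDerivAt_eq_zero hd
    simpa [hε.ne'] using this
  by_contra! hneg
  obtain ⟨z, hz, hz0⟩ : (0 : ℝ) ∈ dx ψ '' Icc y 1 :=
    intermediate_value_Icc h2.le (h.regular.continuousOn_dx.mono (Icc_subset_Icc_left hy.1))
      ⟨hneg.le, hs⟩
  have hf := h.first_integral hε ⟨hy.1.trans hz.1, hz.2⟩ hy
  have hle := etaSteady_le_of_deltaSteady_eq_zero hm h.regular.continuousOn h0 z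
  rw [hz0] at hf
  have : 0 < ε / 2 * dx ψ y ^ 2 := mul_pos (by positivity) (sq_pos_of_neg hneg)
  linarith

theorem mem_Icc (h : IsBoundaryLayer ε γ m₀ φb ψ) (hm : 0 < m₀) (hε : 0 < ε)
    (hγ : 0 < γ) (hφ : 0 < φb) {x : ℝ} (hx : x ∈ Icc (-1 : ℝ) 1) :
    ψ x ∈ Icc (ψ (-1)) (ψ 1) := by
  have hmono : MonotoneOn ψ (Icc (-1) 1) := by
    apply monotoneOn_of_hasDerivWithinAt_nonneg (convex_Icc (-1 : ℝ) 1) h.regular.continuousOn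
      (f' := dx ψ)
    · intro x hx
      rw [interior_Icc] at hx
      exact (PNP.hasDerivAt_dx h.regular.differentiableOn hx).hasDerivWithinAt
    · intro x hx
      exact h.dx_nonneg hm hε hγ hφ (interior_subset hx)
  exact ⟨hmono (by simp) hx hx.1, hmono hx (by simp) hx.2⟩

/-- By monotonicity `ψ` lies between its end values, and the nonnegative end slope in the Robin
conditions gives `ψ(1) - ψ(-1) ≤ 2 φb`. -/
theorem integral_exp_mul_le (h : IsBoundaryLayer ε γ m₀ φb ψ) (hm : 0 < m₀) (hε : 0 < ε)
    (hγ : 0 < γ) (hφ : 0 < φb) :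
    (∫ y in (-1 : ℝ)..1, Real.exp (ψ y)) * (∫ y in (-1 : ℝ)..1, Real.exp (-ψ y))
      ≤ 4 * Real.exp φb ^ 2 := by
  have hc := h.regular.continuousOn
  have bound : ∀ (f : ℝ → ℝ) (c : ℝ), ContinuousOn f (Icc (-1) 1) →
      (∀ x ∈ Icc (-1 : ℝ) 1, f x ≤ c) → ∫ y in (-1 : ℝ)..1, Real.exp (f y) ≤ 2 * Real.exp c := by
    intro f c hf hfc
    calc _ ≤ ∫ _ in (-1 : ℝ)..1, Real.exp c :=
          intervalIntegral.integral_mono_on (by norm_num)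
            (intervalIntegrable_of_continuousOn (Real.continuous_exp.comp_continuousOn hf))
            (by simp) (fun x hx => Real.exp_le_exp.2 (hfc x hx))
      _ = _ := by rw [intervalIntegral.integral_const, smul_eq_mul]; norm_num
  have h1 := bound ψ (ψ 1) hc fun x hx => (h.mem_Icc hm hε hγ hφ hx).2
  have h2 := bound (fun x => -ψ x) (-ψ (-1)) hc.fun_neg fun x hx =>
    neg_le_neg (h.mem_Icc hm hε hγ hφ hx).1
  have hs := h.dx_right_nonneg hm hε hγ hφ
  have hle : ψ 1 + -ψ (-1) ≤ φb + φb := by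
    have hr := h.robin_right
    have hl := h.robin_left
    rw [← h.dx_right_eq_left hε] at hl
    nlinarith
  calc _ ≤ (2 * Real.exp (ψ 1)) * (2 * Real.exp (-ψ (-1))) :=
        mul_le_mul h1 h2 (integral_exp_pos hc.fun_neg).le (by positivity)
    _ = 4 * Real.exp (ψ 1 + -ψ (-1)) := by rw [Real.exp_add]; ring
    _ ≤ 4 * Real.exp (φb + φb) := by gcongr
    _ = _ := by rw [Real.exp_add]; ring

/-- The density `η⁰` is squeezed between a constant and that constant plus `ε ψ_x² / 2`. -/
theorem exists_etaSteady_bounds (h : IsBoundaryLayer ε γ m₀ φb ψ) (hm : 0 < m₀) (hε : 0 < ε)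
    (hγ : 0 < γ) (hφ : 0 < φb) :
    ∃ κ, 2 * constM m₀ φb ^ 2 ≤ κ ∧ ∀ x ∈ Icc (-1 : ℝ) 1,
      κ ≤ etaSteady m₀ ψ x ∧ etaSteady m₀ ψ x ≤ κ + ε / 2 * dx ψ x ^ 2 := by
  have hc := h.regular.continuousOn
  -- Rolle's theorem for `ψ_x`, whose end values agree, gives a zero `y` of `δ⁰`; then `κ = η⁰(y)`
  -- is the minimum of `η⁰`.
  obtain ⟨y, hy, hy0⟩ := exists_hasDerivAt_eq_zero (by norm_num : (-1 : ℝ) < 1)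
    h.regular.continuousOn_dx (h.dx_right_eq_left hε).symm (fun x hx => h.hasDerivAt_dx hε hx)
  have h0 : deltaSteady m₀ ψ y = 0 := by simpa [hε.ne'] using hy0
  refine ⟨etaSteady m₀ ψ y, ?_, fun x hx => ⟨etaSteady_le_of_deltaSteady_eq_zero hm hc h0 x, ?_⟩⟩
  · have hsq : 2 * constM m₀ φb ^ 2 = m₀ / Real.exp φb := by
      rw [constM, Real.sq_sqrt (by positivity)]
      field_simp
    rw [hsq]
    apply le_of_sq_le_sq _ (etaSteady_pos hm hc y).le
    rw [sq_etaSteady, h0, div_pow, div_le_iff₀ (by positivity)]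
    have hZ := mul_pos (integral_exp_pos hc) (integral_exp_pos hc.fun_neg)
    have hle := h.integral_exp_mul_le hm hε hγ hφ
    rw [zero_pow two_ne_zero, zero_add, div_mul_eq_mul_div, le_div_iff₀ hZ]
    nlinarith [mul_le_mul_of_nonneg_left hle (sq_nonneg m₀)]
  · have hf := h.first_integral hε hx (Ioo_subset_Icc_self hy)
    have : 0 ≤ ε / 2 * dx ψ y ^ 2 := by positivity
    linarith

end IsBoundaryLayer

/-! ### The smallness condition -/

/-- The quotient at `y = φb` is already at least `1`. The bound `|e^y - 1| ≤ e^φb |y|` is needed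
because `sSup` of an unbounded set of reals is `0`. -/
theorem one_le_constK {φb : ℝ} (hφ : 0 < φb) : 1 ≤ constK φb := by
  have hbdd : BddAbove ((fun y : ℝ => |Real.exp y - 1| / |y|) '' {y : ℝ | 0 < |y| ∧ |y| ≤ φb}) := by
    refine ⟨Real.exp φb, ?_⟩
    rintro _ ⟨y, ⟨hy, hyb⟩, rfl⟩
    simp only
    rw [div_le_iff₀ hy]
    have h1 : Real.exp φb ≥ 1 := Real.one_le_exp hφ.le
    rcases le_total 0 y with h0 | h0
    · rw [abs_of_nonneg h0] at *
      have h2 : 1 - y ≤ Real.exp (-y) := by linarith [Real.add_one_le_exp (-y)]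
      have h3 : Real.exp y * Real.exp (-y) = 1 := by rw [← Real.exp_add]; simp
      rw [abs_of_nonneg (by linarith [Real.one_le_exp h0])]
      have h4 : Real.exp y ≤ Real.exp φb := Real.exp_le_exp.2 hyb
      nlinarith [Real.exp_pos y]
    · rw [abs_of_nonpos h0, abs_of_nonpos (by linarith [Real.exp_le_one_iff.2 h0])]
      nlinarith [Real.add_one_le_exp y]
  have hmem := le_csSup hbdd ⟨φb, ⟨by rwa [abs_of_pos hφ], by rw [abs_of_pos hφ]⟩, rfl⟩
  refine le_trans ?_ hmem
  simp only
  have := Real.add_one_le_exp φb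
  rw [abs_of_pos hφ, le_div_iff₀ hφ, abs_of_nonneg (by linarith)]
  linarith

/-- The smallness condition on `ε` in the form used by the energy estimate. -/
theorem mul_sq_lt_of_condition {m₀ φb γmax ε γ : ℝ} (hm : 0 < m₀) (hφ : 0 < φb) (hε : 0 < ε)
    (hγ : 0 < γ) (hmax : γ ≤ γmax)
    (h : γ / Real.sqrt ε > ((1 + 2 * γmax) ^ 2 + 3) * constK φb * φb / (4 * constM m₀ φb)) :
    ε * φb ^ 2 < γ ^ 2 * constM m₀ φb ^ 2 := by
  have hM : 0 < constM m₀ φb := Real.sqrt_pos.2 (by positivity)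
  have hs : 0 < Real.sqrt ε := Real.sqrt_pos.2 hε
  have hK := one_le_constK hφ
  rw [gt_iff_lt, div_lt_div_iff₀ (by positivity) hs] at h
  -- The numerator is at least `4 φb`, so the condition implies `γ / √ε > φb / M`, which is then
  -- squared.
  have h1 : 4 ≤ (1 + 2 * γmax) ^ 2 + 3 := by nlinarith
  have h2 : 4 ≤ ((1 + 2 * γmax) ^ 2 + 3) * constK φb := by nlinarith
  have h3 : Real.sqrt ε * φb < γ * constM m₀ φb := by
    nlinarith [mul_le_mul_of_nonneg_right h2 (mul_pos hφ hs).le]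
  have h4 := pow_lt_pow_left₀ h3 (by positivity) two_ne_zero
  rwa [mul_pow, mul_pow, Real.sq_sqrt hε.le] at h4


/-! ### Conservation laws on `(0, ∞) × (-1, 1)` -/

theorem continuousOn_slice {f : ℝ → ℝ → ℝ} {s : Set ℝ}
    (hf : ContinuousOn (fun q : ℝ × ℝ => f q.1 q.2) (Ioi 0 ×ˢ s)) {t : ℝ} (ht : 0 < t) :
    ContinuousOn (f t) s :=
  hf.comp (f := fun x => (t, x)) (by fun_prop) fun _ hx => ⟨ht, hx⟩

/-- Differentiation under the integral sign for integrands that are jointly continuous. -/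
theorem hasDerivAt_integral_of_continuousOn {f f' : ℝ → ℝ → ℝ} {a b : ℝ} (hab : a ≤ b)
    (hf : ContinuousOn (fun q : ℝ × ℝ => f q.1 q.2) (Ioi 0 ×ˢ Icc a b))
    (hf' : ContinuousOn (fun q : ℝ × ℝ => f' q.1 q.2) (Ioi 0 ×ˢ Icc a b))
    (hd : ∀ t > 0, ∀ x ∈ Ioc a b, HasDerivAt (fun s => f s x) (f' t x) t) {t : ℝ} (ht : 0 < t) :
    HasDerivAt (fun s => ∫ x in a..b, f s x) (∫ x in a..b, f' t x) t := by
  have hK : IsCompact (Icc (t / 2) (t + 1) ×ˢ Icc a b) := isCompact_Icc.prod isCompact_Icc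
  have hKs : Icc (t / 2) (t + 1) ×ˢ Icc a b ⊆ Ioi 0 ×ˢ Icc a b :=
    prod_mono_left fun s hs => lt_of_lt_of_le (by positivity) hs.1
  obtain ⟨C, hC⟩ := hK.exists_bound_of_continuousOn (hf'.mono hKs)
  have hmeas : ∀ {g : ℝ → ℝ}, ContinuousOn g (Icc a b) →
      AEStronglyMeasurable g (volume.restrict (uIoc a b)) := fun hg => by
    rw [uIoc_of_le hab]
    exact (hg.mono Ioc_subset_Icc_self).aestronglyMeasurable measurableSet_Ioc
  refine (intervalIntegral.hasDerivAt_integral_of_dominated_loc_of_deriv_le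
    (s := Icc (t / 2) (t + 1)) (bound := fun _ => C)
    (Icc_mem_nhds (by linarith) (by linarith)) ?_ ?_ ?_ ?_ (by simp) ?_).2
  · filter_upwards [lt_mem_nhds ht] with s hs
    exact hmeas (continuousOn_slice hf hs)
  · exact ContinuousOn.intervalIntegrable (by rw [uIcc_of_le hab]; exact continuousOn_slice hf ht)
  · exact hmeas (continuousOn_slice hf' ht)
  · refine Eventually.of_forall fun x hx s hs => hC (s, x) ⟨hs, ?_⟩
    rw [uIoc_of_le hab] at hx
    exact Ioc_subset_Icc_self hx
  · refine Eventually.of_forall fun x hx s hs => hd s ?_ x ?_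
    · exact lt_of_lt_of_le (by positivity) hs.1
    · rwa [uIoc_of_le hab] at hx

/-- Joint continuity at `(t, x₀)` controls a whole neighbourhood of `t` at once. This uniformity
permits passing to the limit in time derivatives as `x` tends to an endpoint. -/
theorem tendstoLocallyUniformlyOn_slice {F : ℝ → ℝ → ℝ} {s : Set ℝ}
    (hF : ContinuousOn (fun q : ℝ × ℝ => F q.1 q.2) (Ioi 0 ×ˢ s)) {x₀ : ℝ} (hx₀ : x₀ ∈ s)
    {l : Filter ℝ} (hl : l ≤ 𝓝[s] x₀) :
    TendstoLocallyUniformlyOn (fun x t => F t x) (fun t => F t x₀) l (Ioi 0) := by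
  rw [Metric.tendstoLocallyUniformlyOn_iff]
  intro e he t ht
  have h := Metric.continuousWithinAt_iff'.1 (hF (t, x₀) ⟨ht, hx₀⟩) (e / 2) (by positivity)
  rw [nhdsWithin_prod_eq] at h
  obtain ⟨U, hU, V, hV, hUV⟩ := mem_prod_iff.1 h
  refine ⟨U, hU, mem_of_superset (hl hV) fun x hx t' ht' => ?_⟩
  have h1 : dist (F t' x) (F t x₀) < e / 2 := hUV (mk_mem_prod ht' hx)
  have h2 : dist (F t' x₀) (F t x₀) < e / 2 := hUV (mk_mem_prod ht' (mem_of_mem_nhdsWithin hx₀ hV))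
  linarith [dist_triangle_right (F t' x₀) (F t' x) (F t x₀)]

theorem tendsto_integral_left {f : ℝ → ℝ} (hf : IntervalIntegrable f volume (-1) 1) {x : ℝ}
    (hx : x ∈ Ioo (-1 : ℝ) 1) :
    Tendsto (fun a => ∫ s in a..x, f s) (𝓝[Ioo (-1) x] (-1)) (𝓝 (∫ s in (-1 : ℝ)..x, f s)) := by
  have hc := continuousOn_primitive hf
  have hx' : x ∈ Icc (-1 : ℝ) 1 := Ioo_subset_Icc_self hx
  have hsub : Ioo (-1 : ℝ) x ⊆ Icc (-1) 1 := fun a ha => ⟨ha.1.le, ha.2.le.trans hx.2.le⟩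
  have h1 : Tendsto (fun a => ∫ s in (-1 : ℝ)..a, f s) (𝓝[Ioo (-1) x] (-1)) (𝓝 0) := by
    have := (hc (-1) (by simp)).mono hsub
    simpa [ContinuousWithinAt] using this
  have h2 := tendsto_const_nhds (x := ∫ s in (-1 : ℝ)..x, f s).sub h1
  rw [sub_zero] at h2
  refine h2.congr' ?_
  filter_upwards [self_mem_nhdsWithin] with a ha
  have hi : ∀ y ∈ Icc (-1 : ℝ) 1, IntervalIntegrable f volume (-1) y := fun y hy =>
    hf.mono_set (by
      rw [uIcc_of_le hy.1, uIcc_of_le (by norm_num)]; exact Icc_subset_Icc_right hy.2)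
  exact intervalIntegral.integral_interval_sub_left (hi x hx') (hi a (hsub ha))

theorem IsParabolicRegular.intervalIntegrable {u : ℝ → ℝ → ℝ} (hu : IsParabolicRegular u) {t : ℝ}
    (ht : 0 < t) : IntervalIntegrable (u t) volume (-1) 1 :=
  intervalIntegrable_of_continuousOn (continuousOn_slice hu.cont ht)

/-- If `u_t = F_x` and `F` vanishes at `x = -1`, then the primitive of `u` has time derivative
`F`. -/
theorem hasDerivAt_prim {u F : ℝ → ℝ → ℝ} (hu : IsParabolicRegular u)
    (hF : ContinuousOn (fun q : ℝ × ℝ => F q.1 q.2) (Ioi 0 ×ˢ Icc (-1) 1))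
    (hFd : ∀ t > 0, ∀ x ∈ Ioo (-1 : ℝ) 1, HasDerivAt (F t) (deriv (fun s => u s x) t) x)
    (hF0 : ∀ t > 0, F t (-1) = 0) {t : ℝ} (ht : 0 < t) {x : ℝ} (hx : x ∈ Ioc (-1 : ℝ) 1) :
    HasDerivAt (fun t => prim u t x) (F t x) t := by
  -- `u_t` is controlled only in the open interval, so differentiation under the integral is done on
  -- `[a, x]` inside it. The limits `a → -1` and then `x → 1` use that the fluxes, unlike `u_t`, are
  -- continuous up to the boundary.
  have inner : ∀ a x : ℝ, -1 < a → a ≤ x → x < 1 → ∀ t > 0,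
      HasDerivAt (fun t => ∫ s in a..x, u t s) (F t x - F t a) t := by
    intro a x ha hax hx t ht
    have hsub : Icc a x ⊆ Ioo (-1) 1 := fun y hy => ⟨ha.trans_le hy.1, hy.2.trans_lt hx⟩
    have h := hasDerivAt_integral_of_continuousOn (f := u)
      (f' := fun t x => deriv (fun s => u s x) t) hax
      (hu.cont.mono (prod_mono_right (hsub.trans Ioo_subset_Icc_self)))
      (hu.cont_t.mono (prod_mono_right hsub))
      (fun t ht y hy => ((hu.diff_t y (hsub (Ioc_subset_Icc_self hy)) t ht).differentiableAt
        (Ioi_mem_nhds ht)).hasDerivAt) ht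
    refine h.congr_deriv ?_
    refine intervalIntegral.integral_eq_sub_of_hasDerivAt_of_le hax
      ((continuousOn_slice hF ht).mono (hsub.trans Ioo_subset_Icc_self))
      (fun y hy => hFd t ht y (hsub (Ioo_subset_Icc_self hy))) ?_
    refine ContinuousOn.intervalIntegrable ?_
    rw [uIcc_of_le hax]
    exact (continuousOn_slice (f := fun t x => deriv (fun s => u s x) t) hu.cont_t ht).mono hsub
  have middle : ∀ x ∈ Ioo (-1 : ℝ) 1, ∀ t > 0,
      HasDerivAt (fun t => prim u t x) (F t x) t := by
    intro x hx t ht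
    have hG : ContinuousOn (fun q : ℝ × ℝ => F q.1 x - F q.1 q.2) (Ioi 0 ×ˢ Icc (-1) 1) :=
      (hF.comp (f := fun q : ℝ × ℝ => (q.1, x)) (by fun_prop)
        fun q hq => ⟨hq.1, Ioo_subset_Icc_self hx⟩).sub hF
    have hne : (𝓝[Ioo (-1) x] (-1 : ℝ)).NeBot := by
      rw [← mem_closure_iff_nhdsWithin_neBot, closure_Ioo hx.1.ne]
      exact ⟨le_rfl, hx.1.le⟩
    have hu' := tendstoLocallyUniformlyOn_slice (F := fun t a => F t x - F t a) hG
      (x₀ := -1) (by simp) (nhdsWithin_mono (s := Ioo (-1) x) _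
        fun a ha => ⟨ha.1.le, ha.2.le.trans hx.2.le⟩)
    have := hasDerivAt_of_tendstoLocallyUniformlyOn (l := 𝓝[Ioo (-1) x] (-1)) isOpen_Ioi
      (f := fun a t => ∫ s in a..x, u t s) (g := fun t => prim u t x)
      hu'
      (by filter_upwards [self_mem_nhdsWithin] with a ha t ht
          exact inner a x ha.1 ha.2.le hx.2 t ht)
      (fun t ht => tendsto_integral_left (hu.intervalIntegrable ht) hx) ht
    simpa [hF0 t ht] using this
  rcases eq_or_lt_of_le hx.2 with h1 | h1
  · subst h1
    have hne : (𝓝[Ioo (-1) 1] (1 : ℝ)).NeBot := by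
      rw [← mem_closure_iff_nhdsWithin_neBot, closure_Ioo (by norm_num)]
      simp
    have hu' := tendstoLocallyUniformlyOn_slice hF (x₀ := 1) (by simp)
      (nhdsWithin_mono (s := Ioo (-1) 1) _ Ioo_subset_Icc_self)
    refine hasDerivAt_of_tendstoLocallyUniformlyOn (l := 𝓝[Ioo (-1) 1] 1) isOpen_Ioi
      (f := fun x t => prim u t x)
      hu'
      (by filter_upwards [self_mem_nhdsWithin] with x hx t ht
          exact middle x hx t ht)
      (fun t ht => ?_) ht
    exact (continuousOn_primitive (hu.intervalIntegrable ht) 1 (by simp)).mono Ioo_subset_Icc_self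
  · exact middle x ⟨hx.1, h1⟩ t ht

theorem continuousOn_prim {u : ℝ → ℝ → ℝ}
    (hu : ContinuousOn (fun q : ℝ × ℝ => u q.1 q.2) (Ioi 0 ×ˢ Icc (-1) 1)) :
    ContinuousOn (fun q : ℝ × ℝ => prim u q.1 q.2) (Ioi 0 ×ˢ Icc (-1) 1) := by
  rintro ⟨t₀, x₀⟩ ⟨ht₀, hx₀⟩
  have ht₀' : 0 < t₀ := ht₀
  -- Clamping time below at `t₀ / 2` and space to `[-1, 1]` makes the integrand continuous on the
  -- whole plane without changing it near `t₀`.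
  have hcont : Continuous
      (Function.uncurry fun t s : ℝ => u (max t (t₀ / 2)) (max (-1) (min 1 s))) :=
    hu.comp_continuous (f := fun q : ℝ × ℝ => (max q.1 (t₀ / 2), max (-1) (min 1 q.2)))
      (by fun_prop) fun q => ⟨mem_Ioi.2 (lt_max_of_lt_right (half_pos ht₀')), le_max_left _ _,
        max_le (by norm_num) (min_le_left _ _)⟩
  have h := intervalIntegral.continuous_parametric_primitive_of_continuous (μ := volume)
    (a₀ := -1) hcont
  refine h.continuousWithinAt.congr_of_eventuallyEq_of_mem ?_ ⟨ht₀, hx₀⟩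
  have hev : ∀ᶠ q : ℝ × ℝ in 𝓝[Ioi 0 ×ˢ Icc (-1) 1] (t₀, x₀), t₀ / 2 < q.1 :=
    nhdsWithin_le_nhds ((continuous_fst.tendsto (t₀, x₀)).eventually
      (lt_mem_nhds (by simp only; linarith)))
  filter_upwards [hev, self_mem_nhdsWithin] with q hq hq'
  refine intervalIntegral.integral_congr fun s hs => ?_
  rw [uIcc_of_le hq'.2.1] at hs
  simp only [max_eq_left hq.le, min_eq_right (hs.2.trans hq'.2.2), max_eq_right hs.1]

/-! ### Attainment of the initial data -/

/-- The bound does not depend on `x`: attainment of the data in `L¹` becomes uniform convergence of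
the primitives, hence convergence of the energy as `t → 0⁺`. -/
theorem abs_prim_sub_prim_zero_le {u : ℝ → ℝ → ℝ} (hu : IsParabolicRegular u)
    (h0 : AttainsInitialData u) {t : ℝ} (ht : 0 < t) {x : ℝ} (hx : x ∈ Icc (-1 : ℝ) 1) :
    |prim u t x - prim u 0 x| ≤ ∫ s in (-1 : ℝ)..1, |u t s - u 0 s| := by
  have hsub : uIcc (-1) x ⊆ uIcc (-1 : ℝ) 1 := by
    rw [uIcc_of_le hx.1, uIcc_of_le (by norm_num)]; exact Icc_subset_Icc_right hx.2
  have hi := (hu.intervalIntegrable ht).sub h0.1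
  rw [prim, prim, ← intervalIntegral.integral_sub ((hu.intervalIntegrable ht).mono_set hsub)
    (h0.1.mono_set hsub)]
  exact (intervalIntegral.abs_integral_le_integral_abs hx.1).trans
    (intervalIntegral.integral_mono_interval le_rfl hx.1 hx.2
      (Eventually.of_forall fun _ => abs_nonneg _) hi.abs)

theorem tendsto_prim {u : ℝ → ℝ → ℝ} (hu : IsParabolicRegular u) (h0 : AttainsInitialData u)
    {x : ℝ} (hx : x ∈ Icc (-1 : ℝ) 1) :
    Tendsto (fun t => prim u t x) (𝓝[>] 0) (𝓝 (prim u 0 x)) := by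
  rw [tendsto_iff_dist_tendsto_zero]
  refine squeeze_zero' (Eventually.of_forall fun _ => dist_nonneg) ?_ h0.2
  filter_upwards [self_mem_nhdsWithin] with t ht
  exact abs_prim_sub_prim_zero_le hu h0 ht hx

theorem tendsto_integral_sq_prim {u : ℝ → ℝ → ℝ} (hu : IsParabolicRegular u)
    (h0 : AttainsInitialData u) :
    Tendsto (fun t => ∫ x in (-1 : ℝ)..1, prim u t x ^ 2) (𝓝[>] 0)
      (𝓝 (∫ x in (-1 : ℝ)..1, prim u 0 x ^ 2)) := by
  obtain ⟨C, hC⟩ := isCompact_Icc.exists_bound_of_continuousOn (continuousOn_primitive h0.1)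
  have hsub : uIoc (-1 : ℝ) 1 ⊆ Icc (-1) 1 := by
    rw [uIoc_of_le (by norm_num)]; exact Ioc_subset_Icc_self
  refine intervalIntegral.tendsto_integral_filter_of_dominated_convergence
    (fun _ => (C + 1) ^ 2) ?_ ?_ (by simp) ?_
  · filter_upwards [self_mem_nhdsWithin] with t ht
    exact (((continuousOn_primitive (hu.intervalIntegrable ht)).pow 2).mono
      hsub).aestronglyMeasurable measurableSet_uIoc
  · filter_upwards [self_mem_nhdsWithin, h0.2.eventually (gt_mem_nhds one_pos)] with t ht hr
    refine Eventually.of_forall fun x hx => ?_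
    have h1 := abs_prim_sub_prim_zero_le hu h0 ht (hsub hx)
    have h2 : |prim u 0 x| ≤ C := hC x (hsub hx)
    rw [norm_pow, Real.norm_eq_abs]
    have h3 : |prim u t x| ≤ C + 1 := by
      have := abs_sub_abs_le_abs_sub (prim u t x) (prim u 0 x)
      linarith
    gcongr
  · exact Eventually.of_forall fun x hx => (tendsto_prim hu h0 (hsub hx)).pow 2

/-- Conservation of mass. -/
theorem prim_one_eq {u : ℝ → ℝ → ℝ} (hu : IsParabolicRegular u) (h0 : AttainsInitialData u)
    (hd : ∀ t > 0, HasDerivAt (fun t => prim u t 1) 0 t) {t : ℝ} (ht : 0 < t) :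
    prim u t 1 = prim u 0 1 := by
  have hconst : ∀ s > 0, prim u s 1 = prim u t 1 := fun s hs =>
    (convex_Ioi (0 : ℝ)).is_const_of_fderivWithin_eq_zero (𝕜 := ℝ)
      (fun s hs => (hd s hs).differentiableAt.differentiableWithinAt)
      (fun s hs => by
        rw [fderivWithin_of_mem_nhds (Ioi_mem_nhds hs)]
        ext; simp [(hd s hs).deriv]) hs ht
  refine tendsto_nhds_unique (tendsto_const_nhds.congr' ?_) (tendsto_prim hu h0 (x := 1) (by simp))
  filter_upwards [self_mem_nhdsWithin] with s hs
  exact (hconst s hs).symm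


/-! ### The energy -/

theorem integral_sq_fluct {f : ℝ → ℝ} (hf : ContinuousOn f (Icc (-1) 1)) :
    ∫ x in (-1 : ℝ)..1, fluct f x ^ 2 = (∫ x in (-1 : ℝ)..1, f x ^ 2) - 2 * mean f ^ 2 := by
  have e : ∀ x, fluct f x ^ 2 = f x ^ 2 - 2 * mean f * f x + mean f ^ 2 := fun x => by
    rw [fluct]; ring
  have i1 := intervalIntegrable_of_continuousOn (hf.fun_pow 2)
  have i2 := (intervalIntegrable_of_continuousOn hf).const_mul (2 * mean f)
  simp_rw [e]
  rw [intervalIntegral.integral_add (i1.sub i2) (by simp), intervalIntegral.integral_sub i1 i2,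
    intervalIntegral.integral_const_mul, intervalIntegral.integral_const, smul_eq_mul]
  have : ∫ x in (-1 : ℝ)..1, f x = 2 * mean f := by rw [mean]; ring
  rw [this]; ring

/-- On an interval of length `2`, `∫ f² = ∫ (f - mean f)² + 2 (mean f)²`, so the terms `d²`, `h²`
restore exactly what the fluctuations omit. -/
theorem energy_eq {δ η : ℝ → ℝ → ℝ} {t : ℝ} (hδ : IntervalIntegrable (δ t) volume (-1) 1)
    (hη : IntervalIntegrable (η t) volume (-1) 1) :
    energy δ η t = 1 / 2 * ((∫ x in (-1 : ℝ)..1, prim δ t x ^ 2)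
      + ∫ x in (-1 : ℝ)..1, prim η t x ^ 2) := by
  have hD : ContinuousOn (prim δ t) (Icc (-1) 1) := continuousOn_primitive hδ
  have hH : ContinuousOn (prim η t) (Icc (-1) 1) := continuousOn_primitive hη
  have i : ∀ {f : ℝ → ℝ}, ContinuousOn f (Icc (-1) 1) →
      IntervalIntegrable (fun x => fluct f x ^ 2) volume (-1) 1 := fun hf =>
    intervalIntegrable_of_continuousOn ((hf.sub continuousOn_const).pow 2)
  rw [energy, intervalIntegral.integral_add (i hD) (i hH), integral_sq_fluct hD,
    integral_sq_fluct hH]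
  ring

/-! ### The energy dissipation at a fixed time -/

/-- Pointwise form of the energy estimate, with `s` for `ψ_x`. The terms up to `k * (η * s + H * (δ₀
/ ε))` form an exact derivative. The rest is estimated by `D² ≥ 2 d D - d²` on the part `κ` of `η₀`,
by `D (D - k) ≥ -k² / 4` on the part `η₀ - κ ≤ ε s² / 2`, and by Young's inequality for `k η s`; the
last two contribute `1/8 + 1/2 = 5/8`. -/
theorem production_le {D H δ η δ' η' η₀ δ₀ s k d κ ε : ℝ} (hε : 0 < ε) (hκ0 : 0 ≤ κ)
    (h1 : κ ≤ η₀) (h2 : η₀ ≤ κ + ε / 2 * s ^ 2) :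
    D * (δ' - η₀ * ((D - k) / ε) - η * s) + H * (η' - δ₀ * ((D - k) / ε) - δ * s)
      ≤ (δ * δ + D * δ') + (η * η + H * η') - ((δ * H + D * η) * s + D * H * (δ₀ / ε))
        + k * (η * s + H * (δ₀ / ε)) - δ ^ 2 - 1 / 2 * η ^ 2 + 5 / 8 * k ^ 2 * s ^ 2
        - κ / ε * (2 * d - k) * D + κ / ε * d ^ 2 := by
  have e2 : κ / ε * ((2 * d - k) * D - d ^ 2) ≤ κ / ε * (D * (D - k)) :=
    mul_le_mul_of_nonneg_left (by linarith [sq_nonneg (D - d)]) (by positivity)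
  have e3 : -(1 / 8 * k ^ 2 * s ^ 2) ≤ (η₀ - κ) * (D * (D - k)) / ε := by
    rw [le_div_iff₀ hε]
    have h3 : -(k ^ 2 / 4) ≤ D * (D - k) := by linarith [sq_nonneg (D - k / 2)]
    have h4 := mul_le_mul_of_nonneg_left h3 (sub_nonneg.2 h1)
    have h5 := mul_le_mul_of_nonneg_left h2 (by positivity : 0 ≤ k ^ 2 / 4)
    linarith
  have e4 : -(k * (η * s)) ≤ 1 / 2 * η ^ 2 + 1 / 2 * k ^ 2 * s ^ 2 := by
    linarith [sq_nonneg (η + k * s)]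
  have e1 : D * (δ' - η₀ * ((D - k) / ε) - η * s) + H * (η' - δ₀ * ((D - k) / ε) - δ * s)
      = (δ * δ + D * δ') + (η * η + H * η') - ((δ * H + D * η) * s + D * H * (δ₀ / ε))
        + k * (η * s + H * (δ₀ / ε)) - δ ^ 2 - η ^ 2 - κ / ε * (D * (D - k))
        - (η₀ - κ) * (D * (D - k)) / ε - k * (η * s) := by ring
  rw [e1]
  linarith

/-- Upper bound for the energy production of profiles `D`, `H` with derivatives `δ`, `η`, in the
field `(D - k) / ε` with `k = (mean D) / (1 + γ)`. -/
theorem IsBoundaryLayer.integral_production_le {ε γ m₀ φb : ℝ} {ψ : ℝ → ℝ}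
    (hb : IsBoundaryLayer ε γ m₀ φb ψ) (hm : 0 < m₀) (hφ : 0 < φb) (hε : 0 < ε) (hγ : 0 < γ)
    (hsmall : ε * φb ^ 2 < γ ^ 2 * constM m₀ φb ^ 2) {D H δ η δ' η' : ℝ → ℝ} {k : ℝ}
    (hk : mean D = (1 + γ) * k)
    (hD : ContinuousOn D (Icc (-1) 1)) (hH : ContinuousOn H (Icc (-1) 1))
    (hδ : ContinuousOn δ (Icc (-1) 1)) (hη : ContinuousOn η (Icc (-1) 1))
    (hδ' : ContinuousOn δ' (Icc (-1) 1)) (hη' : ContinuousOn η' (Icc (-1) 1))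
    (dD : ∀ x ∈ Ioo (-1 : ℝ) 1, HasDerivAt D (δ x) x)
    (dH : ∀ x ∈ Ioo (-1 : ℝ) 1, HasDerivAt H (η x) x)
    (dδ : ∀ x ∈ Ioo (-1 : ℝ) 1, HasDerivAt δ (δ' x) x)
    (dη : ∀ x ∈ Ioo (-1 : ℝ) 1, HasDerivAt η (η' x) x)
    (hD0 : D (-1) = 0) (hD1 : D 1 = 0) (hH0 : H (-1) = 0) (hH1 : H 1 = 0) :
    ∫ x in (-1 : ℝ)..1,
        (D x * (δ' x - etaSteady m₀ ψ x * ((D x - k) / ε) - η x * dx ψ x)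
          + H x * (η' x - deltaSteady m₀ ψ x * ((D x - k) / ε) - δ x * dx ψ x))
      ≤ -(∫ x in (-1 : ℝ)..1, δ x ^ 2) - 1 / 2 * ∫ x in (-1 : ℝ)..1, η x ^ 2 := by
  obtain ⟨κ, hκM, hκ⟩ := hb.exists_etaSteady_bounds hm hε hγ hφ
  have cψ := hb.regular.continuousOn_dx
  have cη₀ := continuousOn_etaSteady (m₀ := m₀) hb.regular.continuousOn
  have cδ₀ := continuousOn_deltaSteady (m₀ := m₀) hb.regular.continuousOn
  set T' : ℝ → ℝ := fun x => (δ x * δ x + D x * δ' x) + (η x * η x + H x * η' x)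
    - ((δ x * H x + D x * η x) * dx ψ x + D x * H x * (deltaSteady m₀ ψ x / ε))
    + k * (η x * dx ψ x + H x * (deltaSteady m₀ ψ x / ε)) with hT'
  have cT' : ContinuousOn T' (Icc (-1) 1) := by fun_prop
  -- `T'` is the derivative of `D δ + H η - D H ψ_x + k H ψ_x`, by `ψ_xx = δ⁰ / ε`; every term
  -- contains `D` or `H` and vanishes at `±1`.
  have hT : ∫ x in (-1 : ℝ)..1, T' x = 0 := by
    rw [integral_eq_sub_of_Ioo (f := fun x => D x * δ x + H x * η x - D x * H x * dx ψ x
      + k * (H x * dx ψ x)) (by fun_prop) (fun x hx => ?_) cT']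
    · simp [hD0, hD1, hH0, hH1]
    · have dψ := hb.hasDerivAt_dx hε hx
      exact ((((dD x hx).mul (dδ x hx)).add ((dH x hx).mul (dη x hx))).sub
        (((dD x hx).mul (dH x hx)).mul dψ)).add (((dH x hx).mul dψ).const_mul k)
  set d := mean D with hd
  have hDint : ∫ x in (-1 : ℝ)..1, D x = 2 * d := by rw [hd, mean]; ring
  set B : ℝ → ℝ := fun x => T' x - δ x ^ 2 - 1 / 2 * η x ^ 2 + 5 / 8 * k ^ 2 * dx ψ x ^ 2
    - κ / ε * (2 * d - k) * D x + κ / ε * d ^ 2 with hB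
  have hpt : ∀ x ∈ Icc (-1 : ℝ) 1,
      D x * (δ' x - etaSteady m₀ ψ x * ((D x - k) / ε) - η x * dx ψ x)
        + H x * (η' x - deltaSteady m₀ ψ x * ((D x - k) / ε) - δ x * dx ψ x) ≤ B x := by
    exact fun x hx => production_le hε (le_trans (by positivity) hκM) (hκ x hx).1 (hκ x hx).2
  refine (intervalIntegral.integral_mono_on (by norm_num)
    (intervalIntegrable_of_continuousOn (by fun_prop))
    (intervalIntegrable_of_continuousOn (by fun_prop)) hpt).trans ?_
  have i1 := intervalIntegrable_of_continuousOn cT'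
  have i2 := intervalIntegrable_of_continuousOn (hδ.fun_pow 2)
  have i3 := (intervalIntegrable_of_continuousOn (hη.fun_pow 2)).const_mul (1 / 2)
  have i4 := (intervalIntegrable_of_continuousOn (cψ.fun_pow 2)).const_mul (5 / 8 * k ^ 2)
  have i5 := (intervalIntegrable_of_continuousOn hD).const_mul (κ / ε * (2 * d - k))
  rw [hB, intervalIntegral.integral_add ((((i1.sub i2).sub i3).add i4).sub i5) (by simp),
    intervalIntegral.integral_sub (((i1.sub i2).sub i3).add i4) i5,
    intervalIntegral.integral_add ((i1.sub i2).sub i3) i4,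
    intervalIntegral.integral_sub (i1.sub i2) i3, intervalIntegral.integral_sub i1 i2,
    intervalIntegral.integral_const_mul, intervalIntegral.integral_const_mul,
    intervalIntegral.integral_const_mul, intervalIntegral.integral_const, smul_eq_mul, hT, hDint,
    hk]
  have hP := hb.integral_sq_dx_le hm hε hγ
  set P := ∫ x in (-1 : ℝ)..1, dx ψ x ^ 2
  have hPκ : P ≤ κ / ε * γ := by
    refine hP.trans ?_
    rw [div_mul_eq_mul_div, div_le_div_iff₀ (by positivity) hε]
    nlinarith [mul_le_mul_of_nonneg_right hκM (sq_nonneg γ), mul_pos hε (pow_pos hφ 2)]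
  have hκε : 0 ≤ κ / ε * γ := le_trans
    (intervalIntegral.integral_nonneg (by norm_num) fun x _ => sq_nonneg _) hPκ
  -- With `d = (1 + γ) k` the remaining terms are `⅝ k² P - 2 (κ / ε) γ (1 + γ) k²`, which is
  -- nonpositive since `P ≤ κ γ / ε`.
  have h1 := mul_le_mul_of_nonneg_left hPκ (sq_nonneg k)
  have h2 : 0 ≤ k ^ 2 * (κ / ε * γ) := mul_nonneg (sq_nonneg k) hκε
  have h3 : 0 ≤ γ * (k ^ 2 * (κ / ε * γ)) := mul_nonneg hγ.le h2
  nlinarith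

/-! ### Linearized solutions -/

/-- The flux `u_x - ρ φ_x - v ψ_x`. -/
def flux (ρ ψ : ℝ → ℝ) (u v φ : ℝ → ℝ → ℝ) (t x : ℝ) : ℝ :=
  dx (u t) x - ρ x * dx (φ t) x - v t x * dx ψ x

theorem continuousOn_flux {ρ ψ : ℝ → ℝ} {u v φ : ℝ → ℝ → ℝ} (hu : IsParabolicRegular u)
    (hv : IsParabolicRegular v) (hρ : ContinuousOn ρ (Icc (-1) 1)) (hψ : IsC1C2 ψ)
    (hφ : ContinuousOn (fun q : ℝ × ℝ => dx (φ q.1) q.2) (Ioi 0 ×ˢ Icc (-1) 1)) :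
    ContinuousOn (fun q : ℝ × ℝ => flux ρ ψ u v φ q.1 q.2) (Ioi 0 ×ˢ Icc (-1) 1) := by
  have hsnd : MapsTo (Prod.snd : ℝ × ℝ → ℝ) (Ioi 0 ×ˢ Icc (-1) 1) (Icc (-1) 1) :=
    fun q hq => hq.2
  exact (hu.cont_x.sub ((hρ.comp continuousOn_snd hsnd).mul hφ)).sub
    (hv.cont.mul (hψ.continuousOn_dx.comp continuousOn_snd hsnd))

theorem hasDerivAt_flux {ρ ψ : ℝ → ℝ} {u v φ : ℝ → ℝ → ℝ} (hu : IsParabolicRegular u)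
    (hv : IsParabolicRegular v) {t x : ℝ} (ht : 0 < t) (hx : x ∈ Ioo (-1 : ℝ) 1)
    (hρ : DifferentiableAt ℝ ρ x) (hψ : IsC1C2 ψ) (hφ : IsC1C2 (φ t)) :
    HasDerivAt (flux ρ ψ u v φ t)
      (dx (dx (u t)) x - dx (fun y => ρ y * dx (φ t) y) x - dx (fun y => v t y * dx ψ y) x) x := by
  have h1 := hasDerivAt_dx_of_Ioo (hu.diff_xx t ht) hx
  have h2 := hρ.hasDerivAt.fun_mul (hasDerivAt_dx_of_Ioo hφ.differentiableOn_dx hx)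
  have h3 := (hasDerivAt_dx (hv.diff_x t ht) hx).fun_mul
    (hasDerivAt_dx_of_Ioo hψ.differentiableOn_dx hx)
  rw [dx_eq_of_hasDerivAt hx h2, dx_eq_of_hasDerivAt hx h3]
  exact (h1.sub h2).sub h3

theorem hasDerivAt_integral_sq_prim {u F : ℝ → ℝ → ℝ} (hu : IsParabolicRegular u)
    (hF : ContinuousOn (fun q : ℝ × ℝ => F q.1 q.2) (Ioi 0 ×ˢ Icc (-1) 1))
    (hd : ∀ t > 0, ∀ x ∈ Ioc (-1 : ℝ) 1, HasDerivAt (fun t => prim u t x) (F t x) t)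
    {t : ℝ} (ht : 0 < t) :
    HasDerivAt (fun t => ∫ x in (-1 : ℝ)..1, prim u t x ^ 2)
      (∫ x in (-1 : ℝ)..1, 2 * (prim u t x * F t x)) t := by
  have hp := continuousOn_prim hu.cont
  refine hasDerivAt_integral_of_continuousOn (f := fun t x => prim u t x ^ 2)
    (f' := fun t x => 2 * (prim u t x * F t x)) (by norm_num)
    (hp.pow 2) (continuousOn_const.mul (hp.mul hF)) (fun t ht x hx => ?_) ht
  exact ((hd t ht x hx).fun_pow 2).congr_deriv (by simp; ring)

namespace IsLinearizedSolution

variable {ε γ m₀ φb : ℝ} {ψ : ℝ → ℝ} {δ η φ : ℝ → ℝ → ℝ}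

/-- The electric field is determined by the charge. -/
theorem dx_phi_eq (h : IsLinearizedSolution ε γ m₀ ψ δ η φ) (hε : 0 < ε) (hγ : 0 < γ) {t : ℝ}
    (ht : 0 < t) {x : ℝ} (hx : x ∈ Icc (-1 : ℝ) 1) :
    dx (φ t) x = (prim δ t x
      - (2 * mean (prim δ t) + γ * prim δ t 1) / (2 * (1 + γ))) / ε := by
  have hδ := continuousOn_slice h.regular_delta.cont ht
  have hφ := h.regular_phi t ht
  have hD : ContinuousOn (prim δ t) (Icc (-1) 1) :=
    continuousOn_primitive (h.regular_delta.intervalIntegrable ht)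
  set c := dx (φ t) (-1) with hc
  have hconst : ∀ x ∈ Icc (-1 : ℝ) 1, dx (φ t) x = prim δ t x / ε + c := by
    intro x hx
    have := eq_of_hasDerivAt_zero (f := fun x => dx (φ t) x - prim δ t x / ε)
      (hφ.continuousOn_dx.sub (hD.div_const ε)) (fun y hy => ?_) hx
      (show (-1 : ℝ) ∈ Icc (-1) 1 by simp)
    · simp only [prim, intervalIntegral.integral_same, zero_div, sub_zero] at this ⊢
      rw [hc]; linarith
    · refine ((hasDerivAt_dx_of_Ioo hφ.differentiableOn_dx hy).sub
        ((hasDerivAt_primitive hδ hy).div_const ε)).congr_deriv ?_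
      rw [← h.eq_phi t ht y hy]
      field_simp
      ring
  -- The constant `c` is fixed by evaluating the potential drop twice: by integrating the field, and
  -- from the Robin conditions.
  have hdiff : ∫ x in (-1 : ℝ)..1, (prim δ t x / ε + c) = φ t 1 - φ t (-1) := by
    rw [← integral_eq_sub_of_Ioo hφ.continuousOn
      (fun x hx => PNP.hasDerivAt_dx hφ.differentiableOn hx) hφ.continuousOn_dx]
    refine intervalIntegral.integral_congr fun x hx => ?_
    rw [uIcc_of_le (by norm_num)] at hx
    exact (hconst x hx).symm
  rw [intervalIntegral.integral_add ((intervalIntegrable_of_continuousOn hD).div_const ε) (by simp),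
    intervalIntegral.integral_div, intervalIntegral.integral_const, smul_eq_mul] at hdiff
  have hmean : ∫ x in (-1 : ℝ)..1, prim δ t x = 2 * mean (prim δ t) := by rw [mean]; ring
  have hr := h.robin_right t ht
  have hl := h.robin_left t ht
  rw [hconst 1 (by simp)] at hr
  rw [← hc] at hl
  rw [hmean] at hdiff
  rw [hconst x hx]
  have hγ1 : (1 + γ) ≠ 0 := by positivity
  field_simp at hdiff hr ⊢
  nlinarith

/-- No regularity of `φ` in time is part of the solution concept; it is inherited from `δ` through
`dx_phi_eq`. -/
theorem continuousOn_dx_phi (h : IsLinearizedSolution ε γ m₀ ψ δ η φ) (hε : 0 < ε)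
    (hγ : 0 < γ) : ContinuousOn (fun q : ℝ × ℝ => dx (φ q.1) q.2) (Ioi 0 ×ˢ Icc (-1) 1) := by
  have hp := continuousOn_prim h.regular_delta.cont
  have hpp := continuousOn_prim hp
  have hone : ContinuousOn (fun q : ℝ × ℝ => (q.1, (1 : ℝ))) (Ioi 0 ×ˢ Icc (-1) 1) := by fun_prop
  have hmaps : MapsTo (fun q : ℝ × ℝ => (q.1, (1 : ℝ))) (Ioi 0 ×ˢ Icc (-1) 1)
      (Ioi 0 ×ˢ Icc (-1) 1) := fun q hq => ⟨hq.1, by simp⟩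
  have hm : ContinuousOn (fun q : ℝ × ℝ => mean (prim δ q.1)) (Ioi 0 ×ˢ Icc (-1) 1) :=
    continuousOn_const.mul (hpp.comp hone hmaps)
  have h1 : ContinuousOn (fun q : ℝ × ℝ => prim δ q.1 1) (Ioi 0 ×ˢ Icc (-1) 1) :=
    hp.comp hone hmaps
  have : ContinuousOn (fun q : ℝ × ℝ => (prim δ q.1 q.2
      - (2 * mean (prim δ q.1) + γ * prim δ q.1 1) / (2 * (1 + γ))) / ε)
      (Ioi 0 ×ˢ Icc (-1) 1) :=
    (hp.sub (((continuousOn_const.mul hm).add (continuousOn_const.mul h1)).div_const _)).div_const _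
  exact this.congr fun q hq => h.dx_phi_eq hε hγ hq.1 hq.2

theorem continuousOn_flux_delta (h : IsLinearizedSolution ε γ m₀ ψ δ η φ) (hψ : IsC1C2 ψ)
    (hε : 0 < ε) (hγ : 0 < γ) :
    ContinuousOn (fun q : ℝ × ℝ => flux (etaSteady m₀ ψ) ψ δ η φ q.1 q.2)
      (Ioi 0 ×ˢ Icc (-1) 1) :=
  continuousOn_flux h.regular_delta h.regular_eta (continuousOn_etaSteady hψ.continuousOn) hψ
    (h.continuousOn_dx_phi hε hγ)

theorem continuousOn_flux_eta (h : IsLinearizedSolution ε γ m₀ ψ δ η φ) (hψ : IsC1C2 ψ)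
    (hε : 0 < ε) (hγ : 0 < γ) :
    ContinuousOn (fun q : ℝ × ℝ => flux (deltaSteady m₀ ψ) ψ η δ φ q.1 q.2)
      (Ioi 0 ×ˢ Icc (-1) 1) :=
  continuousOn_flux h.regular_eta h.regular_delta (continuousOn_deltaSteady hψ.continuousOn) hψ
    (h.continuousOn_dx_phi hε hγ)

theorem hasDerivAt_prim_delta (h : IsLinearizedSolution ε γ m₀ ψ δ η φ) (hψ : IsC1C2 ψ)
    (hε : 0 < ε) (hγ : 0 < γ) {t : ℝ} (ht : 0 < t) {x : ℝ} (hx : x ∈ Ioc (-1 : ℝ) 1) :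
    HasDerivAt (fun t => prim δ t x) (flux (etaSteady m₀ ψ) ψ δ η φ t x) t := by
  refine hasDerivAt_prim h.regular_delta (h.continuousOn_flux_delta hψ hε hγ)
    (fun t ht x hx => ?_) (fun t ht => h.noflux_delta t ht (-1) (by simp)) ht hx
  rw [h.eq_delta t ht x hx]
  exact hasDerivAt_flux h.regular_delta h.regular_eta ht hx
    (hasDerivAt_etaSteady (hasDerivAt_dx hψ.differentiableOn hx)).differentiableAt hψ
    (h.regular_phi t ht)

theorem hasDerivAt_prim_eta (h : IsLinearizedSolution ε γ m₀ ψ δ η φ) (hψ : IsC1C2 ψ)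
    (hε : 0 < ε) (hγ : 0 < γ) {t : ℝ} (ht : 0 < t) {x : ℝ} (hx : x ∈ Ioc (-1 : ℝ) 1) :
    HasDerivAt (fun t => prim η t x) (flux (deltaSteady m₀ ψ) ψ η δ φ t x) t := by
  refine hasDerivAt_prim h.regular_eta (h.continuousOn_flux_eta hψ hε hγ)
    (fun t ht x hx => ?_) (fun t ht => h.noflux_eta t ht (-1) (by simp)) ht hx
  rw [h.eq_eta t ht x hx]
  exact hasDerivAt_flux h.regular_eta h.regular_delta ht hx
    (hasDerivAt_deltaSteady (hasDerivAt_dx hψ.differentiableOn hx)).differentiableAt hψ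
    (h.regular_phi t ht)

theorem prim_delta_one (h : IsLinearizedSolution ε γ m₀ ψ δ η φ) (hψ : IsC1C2 ψ)
    (hε : 0 < ε) (hγ : 0 < γ) (h0 : ∫ x in (-1 : ℝ)..1, δ 0 x = 0) {t : ℝ} (ht : 0 ≤ t) :
    prim δ t 1 = 0 := by
  rcases ht.eq_or_lt with rfl | ht
  · exact h0
  · rw [prim_one_eq h.regular_delta h.initial_delta (fun t ht => ?_) ht]
    · exact h0
    · exact (h.hasDerivAt_prim_delta hψ hε hγ ht (by simp)).congr_deriv
        (h.noflux_delta t ht 1 (by simp))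

theorem prim_eta_one (h : IsLinearizedSolution ε γ m₀ ψ δ η φ) (hψ : IsC1C2 ψ)
    (hε : 0 < ε) (hγ : 0 < γ) (h0 : ∫ x in (-1 : ℝ)..1, η 0 x = 0) {t : ℝ} (ht : 0 ≤ t) :
    prim η t 1 = 0 := by
  rcases ht.eq_or_lt with rfl | ht
  · exact h0
  · rw [prim_one_eq h.regular_eta h.initial_eta (fun t ht => ?_) ht]
    · exact h0
    · exact (h.hasDerivAt_prim_eta hψ hε hγ ht (by simp)).congr_deriv
        (h.noflux_eta t ht 1 (by simp))

theorem intervalIntegrable_delta (h : IsLinearizedSolution ε γ m₀ ψ δ η φ) {t : ℝ} (ht : 0 ≤ t) :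
    IntervalIntegrable (δ t) volume (-1) 1 := by
  rcases ht.eq_or_lt with rfl | ht
  exacts [h.initial_delta.1, h.regular_delta.intervalIntegrable ht]

theorem intervalIntegrable_eta (h : IsLinearizedSolution ε γ m₀ ψ δ η φ) {t : ℝ} (ht : 0 ≤ t) :
    IntervalIntegrable (η t) volume (-1) 1 := by
  rcases ht.eq_or_lt with rfl | ht
  exacts [h.initial_eta.1, h.regular_eta.intervalIntegrable ht]

/-- The energy satisfies a differential inequality. -/
theorem exists_hasDerivAt_energy (h : IsLinearizedSolution ε γ m₀ ψ δ η φ)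
    (hb : IsBoundaryLayer ε γ m₀ φb ψ) (hm : 0 < m₀) (hφ : 0 < φb) (hε : 0 < ε) (hγ : 0 < γ)
    (hsmall : ε * φb ^ 2 < γ ^ 2 * constM m₀ φb ^ 2)
    (hδ0 : ∫ x in (-1 : ℝ)..1, δ 0 x = 0) (hη0 : ∫ x in (-1 : ℝ)..1, η 0 x = 0)
    {t : ℝ} (ht : 0 < t) :
    ∃ E', HasDerivAt (energy δ η) E' t ∧ E' ≤ -(1 / 4) * energy δ η t := by
  have hψ := hb.regular
  have dD := hasDerivAt_integral_sq_prim h.regular_delta (h.continuousOn_flux_delta hψ hε hγ)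
    (fun t ht x hx => h.hasDerivAt_prim_delta hψ hε hγ ht hx) ht
  have dH := hasDerivAt_integral_sq_prim h.regular_eta (h.continuousOn_flux_eta hψ hε hγ)
    (fun t ht x hx => h.hasDerivAt_prim_eta hψ hε hγ ht hx) ht
  refine ⟨_, ((dD.add dH).const_mul (1 / 2)).congr_of_eventuallyEq ?_, ?_⟩
  · filter_upwards [lt_mem_nhds ht] with s hs
    exact energy_eq (h.intervalIntegrable_delta hs.le) (h.intervalIntegrable_eta hs.le)
  have iδ := h.intervalIntegrable_delta ht.le
  have iη := h.intervalIntegrable_eta ht.le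
  have cδ := continuousOn_slice h.regular_delta.cont ht
  have cη := continuousOn_slice h.regular_eta.cont ht
  have cD : ContinuousOn (prim δ t) (Icc (-1) 1) := continuousOn_primitive iδ
  have cH : ContinuousOn (prim η t) (Icc (-1) 1) := continuousOn_primitive iη
  have hD1 := h.prim_delta_one hψ hε hγ hδ0 ht.le
  have hH1 := h.prim_eta_one hψ hε hγ hη0 ht.le
  set k := mean (prim δ t) / (1 + γ) with hk
  have key := hb.integral_production_le hm hφ hε hγ hsmall (D := prim δ t) (H := prim η t)
    (δ := δ t) (η := η t) (δ' := dx (δ t)) (η' := dx (η t)) (k := k)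
    (by rw [hk]; field_simp) cD cH cδ cη
    (continuousOn_slice (f := fun t => dx (δ t)) h.regular_delta.cont_x ht)
    (continuousOn_slice (f := fun t => dx (η t)) h.regular_eta.cont_x ht)
    (fun x hx => hasDerivAt_primitive cδ hx) (fun x hx => hasDerivAt_primitive cη hx)
    (fun x hx => PNP.hasDerivAt_dx (h.regular_delta.diff_x t ht) hx)
    (fun x hx => PNP.hasDerivAt_dx (h.regular_eta.diff_x t ht) hx)
    (by simp [prim]) hD1 (by simp [prim]) hH1
  have hfield : ∀ x ∈ Icc (-1 : ℝ) 1, dx (φ t) x = (prim δ t x - k) / ε := fun x hx => by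
    rw [h.dx_phi_eq hε hγ ht hx, hD1, hk]
    field_simp
    ring
  have cFδ := continuousOn_slice (h.continuousOn_flux_delta hψ hε hγ) ht
  have cFη := continuousOn_slice (h.continuousOn_flux_eta hψ hε hγ) ht
  have e : 1 / 2 * ((∫ x in (-1 : ℝ)..1, 2 * (prim δ t x * flux (etaSteady m₀ ψ) ψ δ η φ t x))
      + ∫ x in (-1 : ℝ)..1, 2 * (prim η t x * flux (deltaSteady m₀ ψ) ψ η δ φ t x))
      = ∫ x in (-1 : ℝ)..1,
        (prim δ t x * (dx (δ t) x - etaSteady m₀ ψ x * ((prim δ t x - k) / ε) - η t x * dx ψ x)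
          + prim η t x
            * (dx (η t) x - deltaSteady m₀ ψ x * ((prim δ t x - k) / ε) - δ t x * dx ψ x)) := by
    rw [intervalIntegral.integral_const_mul, intervalIntegral.integral_const_mul, ← mul_add,
      ← intervalIntegral.integral_add (intervalIntegrable_of_continuousOn (cD.fun_mul cFδ))
        (intervalIntegrable_of_continuousOn (cH.fun_mul cFη)), ← mul_assoc, one_div,
      inv_mul_cancel₀ two_ne_zero, one_mul]
    refine intervalIntegral.integral_congr fun x hx => ?_
    rw [uIcc_of_le (by norm_num)] at hx
    simp only [flux, hfield x hx]
  rw [e]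
  -- Poincaré gives `E ≤ 2 (∫ δ² + ∫ η²)`, so a dissipation of at least `½ (∫ δ² + ∫ η²)` is at
  -- least `E / 4`.
  have pD := integral_sq_primitive_le cδ
  have pH := integral_sq_primitive_le cη
  have nD : 0 ≤ ∫ x in (-1 : ℝ)..1, δ t x ^ 2 :=
    intervalIntegral.integral_nonneg (by norm_num) fun x _ => sq_nonneg _
  rw [energy_eq iδ iη]
  simp only [prim] at key ⊢
  linarith

/-- Exponential decay of the energy. -/
theorem energy_le (h : IsLinearizedSolution ε γ m₀ ψ δ η φ)
    (hb : IsBoundaryLayer ε γ m₀ φb ψ) (hm : 0 < m₀) (hφ : 0 < φb) (hε : 0 < ε) (hγ : 0 < γ)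
    (hsmall : ε * φb ^ 2 < γ ^ 2 * constM m₀ φb ^ 2)
    (hδ0 : ∫ x in (-1 : ℝ)..1, δ 0 x = 0) (hη0 : ∫ x in (-1 : ℝ)..1, η 0 x = 0)
    {t : ℝ} (ht : 0 < t) :
    energy δ η t ≤ energy δ η 0 * Real.exp (-(1 / 4) * t) := by
  choose! E' hE' hle using fun (t : ℝ) (ht : 0 < t) =>
    h.exists_hasDerivAt_energy hb hm hφ hε hγ hsmall hδ0 hη0 ht
  have hd : ∀ s > 0, HasDerivAt (fun s => energy δ η s * Real.exp (1 / 4 * s))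
      (E' s * Real.exp (1 / 4 * s) + energy δ η s * (Real.exp (1 / 4 * s) * (1 / 4))) s := by
    intro s hs
    have h1 : HasDerivAt (fun s : ℝ => 1 / 4 * s) (1 / 4) s := by
      simpa using (hasDerivAt_id s).const_mul (1 / 4 : ℝ)
    exact (hE' s hs).mul h1.exp
  have hanti : AntitoneOn (fun s => energy δ η s * Real.exp (1 / 4 * s)) (Ioi 0) := by
    refine antitoneOn_of_hasDerivWithinAt_nonpos (convex_Ioi 0)
      (fun s hs => (hd s hs).continuousAt.continuousWithinAt)
      (fun s hs => (hd s (interior_subset hs)).hasDerivWithinAt) fun s hs => ?_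
    have := mul_le_mul_of_nonneg_right (hle s (interior_subset hs)) (Real.exp_pos (1 / 4 * s)).le
    linarith
  have hlim : Tendsto (energy δ η) (𝓝[>] 0) (𝓝 (energy δ η 0)) := by
    rw [energy_eq h.initial_delta.1 h.initial_eta.1]
    refine (((tendsto_integral_sq_prim h.regular_delta h.initial_delta).add
      (tendsto_integral_sq_prim h.regular_eta h.initial_eta)).const_mul (1 / 2)).congr' ?_
    filter_upwards [self_mem_nhdsWithin] with s hs
    exact (energy_eq (h.intervalIntegrable_delta (le_of_lt hs))
      (h.intervalIntegrable_eta (le_of_lt hs))).symm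
  have hexp : Tendsto (fun s : ℝ => Real.exp (1 / 4 * s)) (𝓝[>] 0) (𝓝 1) := by
    have hc : Continuous fun s : ℝ => Real.exp (1 / 4 * s) := by fun_prop
    simpa using (hc.tendsto 0).mono_left nhdsWithin_le_nhds
  -- Differentiability holds only for positive times, so monotonicity is compared with time `0`
  -- through the limit `s → 0⁺`.
  have hbound : energy δ η t * Real.exp (1 / 4 * t) ≤ energy δ η 0 * 1 := by
    refine ge_of_tendsto (hlim.mul hexp) ?_
    filter_upwards [self_mem_nhdsWithin, nhdsWithin_le_nhds (gt_mem_nhds ht)] with s hs hst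
    exact hanti hs ht (le_of_lt hst)
  rw [mul_one] at hbound
  have hone : Real.exp (1 / 4 * t) * Real.exp (-(1 / 4) * t) = 1 := by
    rw [← Real.exp_add]; simp
  calc energy δ η t = energy δ η t * Real.exp (1 / 4 * t) * Real.exp (-(1 / 4) * t) := by
        rw [mul_assoc, hone, mul_one]
    _ ≤ _ := by gcongr

end IsLinearizedSolution


/-! ### The space `H¹(-1, 1)` -/

theorem integral_eq_intervalIntegral_of_support_subset {g : ℝ → ℝ}
    (hg : Function.support g ⊆ Ioo (-1) 1) : ∫ x, g x = ∫ x in (-1 : ℝ)..1, g x := by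
  rw [intervalIntegral.integral_of_le (by norm_num),
    setIntegral_eq_integral_of_forall_compl_eq_zero fun x hx => ?_]
  by_contra h
  exact hx (Ioo_subset_Ioc_self (hg h))

/-- A smooth function with integral zero and support in `[-r, r]` has a primitive with support in
`[-r, r]`. -/
theorem exists_primitive_of_integral_eq_zero {θ : ℝ → ℝ} {r : ℝ} (hr1 : r < 1)
    (hθ : ContDiff ℝ ((⊤ : ℕ∞) : WithTop ℕ∞) θ) (hs : ∀ x, x ∉ Icc (-r) r → θ x = 0)
    (h0 : ∫ x in (-1 : ℝ)..1, θ x = 0) :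
    ∃ ζ : ℝ → ℝ, ContDiff ℝ ((⊤ : ℕ∞) : WithTop ℕ∞) ζ ∧ HasCompactSupport ζ ∧
      tsupport ζ ⊆ Ioo (-1) 1 ∧ ∀ x, deriv ζ x = θ x := by
  have hc : Continuous θ := hθ.continuous
  have hd : ∀ x, HasDerivAt (fun x => ∫ s in (-1 : ℝ)..x, θ s) (θ x) x := fun x =>
    hc.integral_hasStrictDerivAt (-1) x |>.hasDerivAt
  have hderiv : deriv (fun x => ∫ s in (-1 : ℝ)..x, θ s) = θ := funext fun x => (hd x).deriv
  have hleft : ∀ x < -r, ∫ s in (-1 : ℝ)..x, θ s = 0 := fun x hx => by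
    refine intervalIntegral.integral_zero_ae (Eventually.of_forall fun s hs' => hs s fun h => ?_)
    have := (uIoc_subset_uIcc hs').2
    exact absurd h.1 (not_le.2 (this.trans_lt (max_lt (by linarith) hx)))
  have hright : ∀ x, r < x → ∫ s in (-1 : ℝ)..x, θ s = 0 := fun x hx => by
    have h1 : ∫ s in (1 : ℝ)..x, θ s = 0 := by
      refine intervalIntegral.integral_zero_ae (Eventually.of_forall fun s hs' => hs s fun h => ?_)
      have := (uIoc_subset_uIcc hs').1
      exact absurd h.2 (not_le.2 ((lt_min hr1 hx).trans_le this))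
    rw [← intervalIntegral.integral_add_adjacent_intervals (hc.intervalIntegrable _ 1)
      (hc.intervalIntegrable _ _), h0, h1, add_zero]
  have hsupp : Function.support (fun x => ∫ s in (-1 : ℝ)..x, θ s) ⊆ Icc (-r) r := by
    intro x hx
    by_contra h
    rw [mem_Icc, not_and_or, not_le, not_le] at h
    exact hx (h.elim (hleft x) (hright x))
  have hts := closure_minimal hsupp isClosed_Icc
  refine ⟨_, contDiff_infty_iff_deriv.2 ⟨fun x => (hd x).differentiableAt, by rwa [hderiv]⟩,
    HasCompactSupport.of_support_subset_isCompact isCompact_Icc hsupp, ?_, fun x => (hd x).deriv⟩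
  exact hts.trans fun x hx => ⟨by linarith [hx.1], by linarith [hx.2]⟩

/-- Du Bois-Reymond lemma: a function with vanishing weak derivative is constant. -/
theorem ae_eq_const_of_integral_mul_deriv_eq_zero {g : ℝ → ℝ}
    (hg : IntervalIntegrable g volume (-1) 1)
    (h : ∀ ζ : ℝ → ℝ, ContDiff ℝ ((⊤ : ℕ∞) : WithTop ℕ∞) ζ → HasCompactSupport ζ →
      tsupport ζ ⊆ Ioo (-1) 1 → ∫ x in (-1 : ℝ)..1, g x * deriv ζ x = 0) :
    ∃ c, ∀ᵐ x, x ∈ Ioo (-1 : ℝ) 1 → g x = c := by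
  let χ₀ : ContDiffBump (0 : ℝ) := ⟨1 / 4, 1 / 2, by norm_num, by norm_num⟩
  set χ : ℝ → ℝ := χ₀.normed volume with hχ
  have hχd : ContDiff ℝ ((⊤ : ℕ∞) : WithTop ℕ∞) χ := χ₀.contDiff_normed
  have hχs : ∀ x, x ∉ Icc (-(1 / 2) : ℝ) (1 / 2) → χ x = 0 := fun x hx => by
    by_contra hne
    have : x ∈ Function.support χ := hne
    rw [hχ, χ₀.support_normed_eq, Metric.mem_ball, Real.dist_eq, sub_zero] at this
    exact hx ⟨(abs_lt.1 this).1.le, (abs_lt.1 this).2.le⟩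
  have hχ1 : ∫ x in (-1 : ℝ)..1, χ x = 1 := by
    rw [← integral_eq_intervalIntegral_of_support_subset, χ₀.integral_normed]
    intro x hx
    by_contra hx'
    exact hx (hχs x fun h => hx' ⟨by linarith [h.1], by linarith [h.2]⟩)
  set c := ∫ x in (-1 : ℝ)..1, g x * χ x with hc
  refine ⟨c, ?_⟩
  have hgc : IntervalIntegrable (fun x => g x - c) volume (-1) 1 := hg.sub (by simp)
  have hloc : LocallyIntegrableOn (fun x => g x - c) (Ioo (-1) 1) volume := by
    refine IntegrableOn.locallyIntegrableOn ?_
    rw [intervalIntegrable_iff_integrableOn_Ioo_of_le (by norm_num)] at hgc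
    exact hgc
  have := isOpen_Ioo.ae_eq_zero_of_integral_contDiff_smul_eq_zero hloc fun θ hθ hθc hθs => ?_
  · filter_upwards [this] with x hx hx'
    linarith [hx hx']
  -- For an arbitrary test function `θ` with integral `m`, `θ - m χ` has integral zero and is
  -- therefore the derivative of a test function. A common `r < 1` keeps that primitive compactly
  -- supported in `(-1, 1)`.
  · obtain ⟨r, hr1, hθr, hχr⟩ : ∃ r : ℝ, r < 1 ∧ (∀ x, x ∉ Icc (-r) r → θ x = 0) ∧
        ∀ x, x ∉ Icc (-r) r → χ x = 0 := by
      have hK : IsCompact (tsupport θ ∪ Icc (-(1 / 2)) (1 / 2)) := hθc.isCompact.union isCompact_Icc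
      obtain ⟨x₀, hx₀, hmax⟩ := hK.exists_isMaxOn (f := fun x : ℝ => |x|)
        ⟨0, Or.inr (by norm_num)⟩ continuous_abs.continuousOn
      have hsub : ∀ x ∈ tsupport θ ∪ Icc (-(1 / 2)) (1 / 2), x ∈ Icc (-|x₀|) |x₀| := fun x hx =>
        abs_le.1 (hmax hx)
      refine ⟨|x₀|, ?_, fun x hx => ?_, fun x hx => ?_⟩
      · rcases hx₀ with hx₀ | hx₀
        · exact abs_lt.2 (hθs hx₀)
        · exact (abs_le.2 hx₀).trans_lt (by norm_num)
      · exact image_eq_zero_of_notMem_tsupport fun hx' => hx (hsub x (Or.inl hx'))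
      · exact hχs x fun hx' => hx (hsub x (Or.inr hx'))
    set m := ∫ x in (-1 : ℝ)..1, θ x with hm
    have iθ : IntervalIntegrable θ volume (-1) 1 := hθ.continuous.intervalIntegrable _ _
    have iχ : IntervalIntegrable χ volume (-1) 1 := hχd.continuous.intervalIntegrable _ _
    have igθ : IntervalIntegrable (fun x => g x * θ x) volume (-1) 1 :=
      hg.mul_continuousOn hθ.continuous.continuousOn
    have igχ : IntervalIntegrable (fun x => g x * χ x) volume (-1) 1 :=
      hg.mul_continuousOn hχd.continuous.continuousOn
    obtain ⟨ζ, hζ, hζc, hζs, hζd⟩ := exists_primitive_of_integral_eq_zero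
      (θ := fun x => θ x - m * χ x)
      hr1 (hθ.sub (contDiff_const.mul hχd))
      (fun x hx => by rw [hθr x hx, hχr x hx, mul_zero, sub_zero])
      (by rw [intervalIntegral.integral_sub iθ (iχ.const_mul m),
        intervalIntegral.integral_const_mul, hχ1, mul_one, sub_self])
    have h1 := h ζ hζ hζc hζs
    simp_rw [hζd] at h1
    have e1 : ∫ x in (-1 : ℝ)..1, g x * (θ x - m * χ x)
        = (∫ x in (-1 : ℝ)..1, g x * θ x) - m * c := by
      rw [hc, ← intervalIntegral.integral_const_mul,
        ← intervalIntegral.integral_sub igθ (igχ.const_mul m)]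
      congr 1; ext x; ring
    have e2 : ∫ x in (-1 : ℝ)..1, θ x • (g x - c) = (∫ x in (-1 : ℝ)..1, g x * θ x) - c * m := by
      rw [hm, ← intervalIntegral.integral_const_mul,
        ← intervalIntegral.integral_sub igθ (iθ.const_mul c)]
      congr 1; ext x; rw [smul_eq_mul]; ring
    rw [integral_eq_intervalIntegral_of_support_subset, e2]
    · linarith
    · intro x hx
      refine hθs (subset_tsupport _ fun h0 => hx ?_)
      simp [h0]

theorem intervalIntegrable_of_memLp_two {f : ℝ → ℝ}
    (hf : MemLp f 2 (volume.restrict (Ioo (-1) 1))) : IntervalIntegrable f volume (-1) 1 := by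
  rw [intervalIntegrable_iff_integrableOn_Ioo_of_le (by norm_num)]
  exact hf.integrable (by norm_num)

theorem intervalIntegrable_sq_of_memLp_two {f : ℝ → ℝ}
    (hf : MemLp f 2 (volume.restrict (Ioo (-1) 1))) :
    IntervalIntegrable (fun x => f x ^ 2) volume (-1) 1 := by
  rw [intervalIntegrable_iff_integrableOn_Ioo_of_le (by norm_num)]
  exact hf.integrable_sq

theorem memLp_two_of_continuousOn {f : ℝ → ℝ} (hf : ContinuousOn f (Icc (-1) 1)) :
    MemLp f 2 (volume.restrict (Ioo (-1) 1)) := by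
  obtain ⟨C, hC⟩ := isCompact_Icc.exists_bound_of_continuousOn hf
  refine MemLp.of_bound ((hf.mono Ioo_subset_Icc_self).aestronglyMeasurable measurableSet_Ioo) C ?_
  filter_upwards [ae_restrict_mem measurableSet_Ioo] with x hx
  exact hC x (Ioo_subset_Icc_self hx)

theorem integral_primitive_mul_deriv {w ζ : ℝ → ℝ} (hw : IntervalIntegrable w volume (-1) 1)
    (hζ : ContDiff ℝ ((⊤ : ℕ∞) : WithTop ℕ∞) ζ) (hs : tsupport ζ ⊆ Ioo (-1) 1) :
    ∫ x in (-1 : ℝ)..1, (∫ s in (-1 : ℝ)..x, w s) * deriv ζ x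
      = -∫ x in (-1 : ℝ)..1, w x * ζ x := by
  have hc : Continuous (deriv ζ) := hζ.continuous_deriv (by simp)
  have hprim : ∀ x, ∫ s in (-1 : ℝ)..x, deriv ζ s = ζ x := fun x => by
    rw [intervalIntegral.integral_deriv_eq_sub
      (fun x _ => (hζ.differentiable (by simp)).differentiableAt) (hc.intervalIntegrable _ _),
      image_eq_zero_of_notMem_tsupport fun h => lt_irrefl _ (hs h).1, sub_zero]
  have hone : ζ 1 = 0 := image_eq_zero_of_notMem_tsupport fun h => lt_irrefl _ (hs h).2
  have h := integral_mul_primitive (hc.intervalIntegrable (-1) 1) hw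
  simp_rw [hprim, hone, zero_mul, zero_sub] at h
  simp_rw [mul_comm _ (deriv ζ _), h, mul_comm (ζ _)]

/-- Subtracting the primitive of `w` leaves a function with zero weak derivative, to which the Du
Bois-Reymond lemma applies. -/
theorem IsH1.exists_ae_eq {v w : ℝ → ℝ} (h : IsH1 v w) :
    ∃ c, ∀ᵐ x, x ∈ Ioo (-1 : ℝ) 1 → v x = c + ∫ s in (-1 : ℝ)..x, w s := by
  have iv := intervalIntegrable_of_memLp_two h.memLp
  have iw := intervalIntegrable_of_memLp_two h.memLp_deriv
  have iW := intervalIntegrable_of_continuousOn (continuousOn_primitive iw)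
  obtain ⟨c, hc⟩ := ae_eq_const_of_integral_mul_deriv_eq_zero
    (g := fun x => v x - ∫ s in (-1 : ℝ)..x, w s) (iv.sub iW) fun ζ hζ hζc hζs => by
      have hcd : Continuous (deriv ζ) := hζ.continuous_deriv (by simp)
      simp_rw [sub_mul]
      rw [intervalIntegral.integral_sub (iv.mul_continuousOn hcd.continuousOn)
        (iW.mul_continuousOn hcd.continuousOn), h.weak ζ hζ hζc hζs,
        integral_primitive_mul_deriv iw hζ hζs, sub_self]
  refine ⟨c, ?_⟩
  filter_upwards [hc] with x hx hx'
  linarith [hx hx']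

theorem isH1_const (c : ℝ) : IsH1 (fun _ => c) (fun _ => 0) where
  memLp := memLp_const c
  memLp_deriv := memLp_const 0
  weak ζ hζ _ hs := by
    have hc : Continuous (deriv ζ) := hζ.continuous_deriv (by simp)
    rw [intervalIntegral.integral_const_mul, intervalIntegral.integral_deriv_eq_sub
      (fun x _ => (hζ.differentiable (by simp)).differentiableAt) (hc.intervalIntegrable _ _),
      image_eq_zero_of_notMem_tsupport fun h => lt_irrefl _ (hs h).1,
      image_eq_zero_of_notMem_tsupport fun h => lt_irrefl _ (hs h).2]
    simp

theorem isH1_const_mul_primitive {g : ℝ → ℝ} (hg : ContinuousOn g (Icc (-1) 1)) (a : ℝ) :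
    IsH1 (fun x => a * ∫ s in (-1 : ℝ)..x, g s) (fun x => a * g x) where
  memLp := memLp_two_of_continuousOn
    (continuousOn_const.mul (continuousOn_primitive (intervalIntegrable_of_continuousOn hg)))
  memLp_deriv := memLp_two_of_continuousOn (continuousOn_const.mul hg)
  weak ζ hζ _ hs := by
    simp_rw [mul_assoc]
    rw [intervalIntegral.integral_const_mul, intervalIntegral.integral_const_mul,
      integral_primitive_mul_deriv (intervalIntegrable_of_continuousOn hg) hζ hs, mul_neg]

/-! ### The norm in the dual of `H¹(-1, 1)` -/

/-- Because `f` has integral zero, both the additive constant in `v` and the boundary term at `1`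
drop out. -/
theorem integral_mul_eq_of_isH1 {f v w : ℝ → ℝ} (hf : IntervalIntegrable f volume (-1) 1)
    (hf0 : ∫ x in (-1 : ℝ)..1, f x = 0) (h : IsH1 v w) :
    ∫ x in (-1 : ℝ)..1, f x * v x = -∫ x in (-1 : ℝ)..1, (∫ s in (-1 : ℝ)..x, f s) * w x := by
  obtain ⟨c, hc⟩ := h.exists_ae_eq
  have iw := intervalIntegrable_of_memLp_two h.memLp_deriv
  have cW := continuousOn_primitive iw
  have e : ∫ x in (-1 : ℝ)..1, f x * v x
      = ∫ x in (-1 : ℝ)..1, (c * f x + f x * ∫ s in (-1 : ℝ)..x, w s) := by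
    refine intervalIntegral.integral_congr_ae ?_
    have hne : ∀ᵐ x : ℝ, x ≠ 1 := by simp [ae_iff]
    filter_upwards [hc, hne] with x hx hx1 hxI
    rw [uIoc_of_le (by norm_num)] at hxI
    rw [hx ⟨hxI.1, lt_of_le_of_ne hxI.2 hx1⟩]
    ring
  have i2 : IntervalIntegrable (fun x => f x * ∫ s in (-1 : ℝ)..x, w s) volume (-1) 1 :=
    hf.mul_continuousOn (by rwa [uIcc_of_le (by norm_num)])
  rw [e, intervalIntegral.integral_add (hf.const_mul c) i2, intervalIntegral.integral_const_mul,
    hf0, integral_mul_primitive hf iw, hf0]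
  ring

theorem integral_mul_le_of_isH1 {f v w : ℝ → ℝ} (hf : IntervalIntegrable f volume (-1) 1)
    (hf0 : ∫ x in (-1 : ℝ)..1, f x = 0) (h : IsH1 v w)
    (h1 : l2Norm v ^ 2 + l2Norm w ^ 2 = 1) :
    ∫ x in (-1 : ℝ)..1, f x * v x ≤ l2Norm fun x => ∫ s in (-1 : ℝ)..x, f s := by
  have cP := continuousOn_primitive hf
  have iw := intervalIntegrable_of_memLp_two h.memLp_deriv
  rw [integral_mul_eq_of_isH1 hf hf0 h]
  have hcs := abs_integral_mul_le_l2Norm (intervalIntegrable_of_continuousOn (cP.pow 2))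
    (intervalIntegrable_sq_of_memLp_two h.memLp_deriv)
    (iw.continuousOn_mul (by rwa [uIcc_of_le (by norm_num)]))
  have hw : l2Norm w ≤ 1 := by nlinarith [sq_nonneg (l2Norm v), l2Norm_nonneg w]
  have := mul_le_mul_of_nonneg_left hw (l2Norm_nonneg fun x => ∫ s in (-1 : ℝ)..x, f s)
  linarith [neg_abs_le (∫ x in (-1 : ℝ)..1, (∫ s in (-1 : ℝ)..x, f s) * w x)]

theorem hMinusOneNorm_le {f : ℝ → ℝ} (hf : IntervalIntegrable f volume (-1) 1)
    (hf0 : ∫ x in (-1 : ℝ)..1, f x = 0) :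
    hMinusOneNorm f ≤ l2Norm fun x => ∫ s in (-1 : ℝ)..x, f s := by
  refine Real.sSup_le ?_ (l2Norm_nonneg _)
  rintro _ ⟨v, w, h, h1, rfl⟩
  exact integral_mul_le_of_isH1 hf hf0 h h1

theorem integral_mul_le_hMinusOneNorm {f v w : ℝ → ℝ} (hf : IntervalIntegrable f volume (-1) 1)
    (hf0 : ∫ x in (-1 : ℝ)..1, f x = 0) (h : IsH1 v w)
    (h1 : l2Norm v ^ 2 + l2Norm w ^ 2 = 1) :
    ∫ x in (-1 : ℝ)..1, f x * v x ≤ hMinusOneNorm f := by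
  refine le_csSup ⟨l2Norm fun x => ∫ s in (-1 : ℝ)..x, f s, ?_⟩ ⟨v, w, h, h1, rfl⟩
  rintro _ ⟨v, w, h, h1, rfl⟩
  exact integral_mul_le_of_isH1 hf hf0 h h1

/-- The constant `√(1/2)` has unit `H¹` norm on an interval of length `2` and pairs to zero with
`f`. -/
theorem hMinusOneNorm_nonneg {f : ℝ → ℝ} (hf : IntervalIntegrable f volume (-1) 1)
    (hf0 : ∫ x in (-1 : ℝ)..1, f x = 0) : 0 ≤ hMinusOneNorm f := by
  have h := integral_mul_le_hMinusOneNorm hf hf0 (isH1_const (Real.sqrt (1 / 2))) (by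
    rw [l2Norm_sq, l2Norm_sq, Real.sq_sqrt (by norm_num)]
    simp; norm_num)
  rwa [intervalIntegral.integral_mul_const, hf0, zero_mul] at h

/-- The test function is `-1 / √A` times the primitive of `P`, normalized in `H¹`; it pairs with `f`
to `‖P‖² / √A`. Poincaré gives `A ≤ (4 + 1) ‖P‖²`, and `√5 ≤ 3`. -/
theorem l2Norm_primitive_le {f : ℝ → ℝ} (hf : IntervalIntegrable f volume (-1) 1)
    (hf0 : ∫ x in (-1 : ℝ)..1, f x = 0) :
    (l2Norm fun x => ∫ s in (-1 : ℝ)..x, f s) ≤ 3 * hMinusOneNorm f := by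
  set P : ℝ → ℝ := fun x => ∫ s in (-1 : ℝ)..x, f s with hP
  have cP : ContinuousOn P (Icc (-1) 1) := continuousOn_primitive hf
  have hn := l2Norm_nonneg P
  rcases hn.eq_or_lt with h0 | hpos
  · rw [← h0]
    exact mul_nonneg (by norm_num) (hMinusOneNorm_nonneg hf hf0)
  set A := l2Norm (fun x => ∫ s in (-1 : ℝ)..x, P s) ^ 2 + l2Norm P ^ 2 with hA
  have hApos : 0 < A := by positivity
  have hA5 : A ≤ 5 * l2Norm P ^ 2 := by
    have := integral_sq_primitive_le cP
    rw [hA, l2Norm_sq, l2Norm_sq]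
    linarith
  set a := -(1 / Real.sqrt A) with ha
  have ha2 : a ^ 2 * A = 1 := by
    rw [ha, neg_sq, div_pow, one_pow, Real.sq_sqrt hApos.le]
    field_simp
  have hscale : ∀ g : ℝ → ℝ, l2Norm (fun x => a * g x) ^ 2 = a ^ 2 * l2Norm g ^ 2 := fun g => by
    rw [l2Norm_sq, l2Norm_sq, ← intervalIntegral.integral_const_mul]
    congr 1; ext x; ring
  have hH1 := isH1_const_mul_primitive cP a
  have h := integral_mul_le_hMinusOneNorm hf hf0 hH1 (by
    rw [hscale, hscale, ← mul_add, ← hA, ha2])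
  rw [integral_mul_eq_of_isH1 hf hf0 hH1] at h
  have e : -∫ x in (-1 : ℝ)..1, (∫ s in (-1 : ℝ)..x, f s) * (a * P x)
      = l2Norm P ^ 2 / Real.sqrt A := by
    rw [l2Norm_sq, div_eq_mul_one_div, mul_comm, ← neg_eq_iff_eq_neg.2 ha, neg_mul,
      ← intervalIntegral.integral_const_mul]
    congr 2; ext x; rw [hP]; ring
  rw [e] at h
  have hsA : 0 < Real.sqrt A := Real.sqrt_pos.2 hApos
  have hs3 : Real.sqrt A ≤ 3 * l2Norm P := by
    rw [Real.sqrt_le_left (by positivity)]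
    nlinarith
  rw [div_le_iff₀ hsA] at h
  have h2 := mul_le_mul_of_nonneg_left hs3 (hMinusOneNorm_nonneg hf hf0)
  nlinarith

/-! ### Charge densities -/

theorem l2Norm_add_le {f g : ℝ → ℝ} (hf : ContinuousOn f (Icc (-1) 1))
    (hg : ContinuousOn g (Icc (-1) 1)) : l2Norm (fun x => f x + g x) ≤ l2Norm f + l2Norm g := by
  apply le_of_sq_le_sq _ (add_nonneg (l2Norm_nonneg f) (l2Norm_nonneg g))
  have i1 := intervalIntegrable_of_continuousOn (hf.fun_pow 2)
  have i2 := intervalIntegrable_of_continuousOn (hf.fun_mul hg)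
  have i3 := intervalIntegrable_of_continuousOn (hg.fun_pow 2)
  have hcs := (le_abs_self _).trans (abs_integral_mul_le_l2Norm i1 i3 i2)
  have e : l2Norm (fun x => f x + g x) ^ 2
      = l2Norm f ^ 2 + 2 * (∫ x in (-1 : ℝ)..1, f x * g x) + l2Norm g ^ 2 := by
    rw [l2Norm_sq, l2Norm_sq, l2Norm_sq, ← intervalIntegral.integral_const_mul,
      ← intervalIntegral.integral_add i1 (i2.const_mul 2),
      ← intervalIntegral.integral_add (i1.add (i2.const_mul 2)) i3]
    congr 1; ext x; ring
  rw [e]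
  nlinarith

theorem l2Norm_const_mul (a : ℝ) (f : ℝ → ℝ) : l2Norm (fun x => a * f x) = |a| * l2Norm f := by
  rw [l2Norm, l2Norm, ← Real.sqrt_sq_eq_abs, ← Real.sqrt_mul (sq_nonneg a),
    ← intervalIntegral.integral_const_mul]
  congr 2; ext x; ring

section Densities

variable {δ η : ℝ → ℝ → ℝ} {t : ℝ}

theorem prim_nTilde (hδ : IntervalIntegrable (δ t) volume (-1) 1)
    (hη : IntervalIntegrable (η t) volume (-1) 1) {x : ℝ} (hx : x ∈ Icc (-1 : ℝ) 1) :
    prim (nTilde δ η) t x = 1 / 2 * prim δ t x + 1 / 2 * prim η t x := by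
  have hsub : uIcc (-1) x ⊆ uIcc (-1 : ℝ) 1 := by
    rw [uIcc_of_le hx.1, uIcc_of_le (by norm_num)]; exact Icc_subset_Icc_right hx.2
  simp only [prim, nTilde]
  rw [intervalIntegral.integral_div,
    intervalIntegral.integral_add (hδ.mono_set hsub) (hη.mono_set hsub)]
  ring

theorem prim_pTilde (hδ : IntervalIntegrable (δ t) volume (-1) 1)
    (hη : IntervalIntegrable (η t) volume (-1) 1) {x : ℝ} (hx : x ∈ Icc (-1 : ℝ) 1) :
    prim (pTilde δ η) t x = 1 / 2 * prim η t x + -(1 / 2) * prim δ t x := by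
  have hsub : uIcc (-1) x ⊆ uIcc (-1 : ℝ) 1 := by
    rw [uIcc_of_le hx.1, uIcc_of_le (by norm_num)]; exact Icc_subset_Icc_right hx.2
  simp only [prim, pTilde]
  rw [intervalIntegral.integral_div,
    intervalIntegral.integral_sub (hη.mono_set hsub) (hδ.mono_set hsub)]
  ring

theorem l2Norm_congr {f g : ℝ → ℝ} (h : ∀ x ∈ Icc (-1 : ℝ) 1, f x = g x) :
    l2Norm f = l2Norm g := by
  rw [l2Norm, l2Norm]
  congr 1
  refine intervalIntegral.integral_congr fun x hx => ?_
  rw [uIcc_of_le (by norm_num)] at hx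
  simp only [h x hx]

/-- Comparison of the norms of the densities and of the primitives. -/
theorem hMinusOneNorm_densities (hδ : IntervalIntegrable (δ t) volume (-1) 1)
    (hη : IntervalIntegrable (η t) volume (-1) 1) (hδ1 : prim δ t 1 = 0) (hη1 : prim η t 1 = 0) :
    1 / 6 * (l2Norm (prim δ t) + l2Norm (prim η t))
        ≤ hMinusOneNorm (nTilde δ η t) + hMinusOneNorm (pTilde δ η t) ∧
      hMinusOneNorm (nTilde δ η t) + hMinusOneNorm (pTilde δ η t)
        ≤ 1 * (l2Norm (prim δ t) + l2Norm (prim η t)) ∧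
      hMinusOneNorm (nTilde δ η t) ^ 2 + hMinusOneNorm (pTilde δ η t) ^ 2 ≤ energy δ η t := by
  have cD : ContinuousOn (prim δ t) (Icc (-1) 1) := continuousOn_primitive hδ
  have cH : ContinuousOn (prim η t) (Icc (-1) 1) := continuousOn_primitive hη
  have iN : IntervalIntegrable (nTilde δ η t) volume (-1) 1 := (hδ.add hη).div_const 2
  have iP : IntervalIntegrable (pTilde δ η t) volume (-1) 1 := (hη.sub hδ).div_const 2
  have cN : ContinuousOn (prim (nTilde δ η) t) (Icc (-1) 1) := continuousOn_primitive iN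
  have cP : ContinuousOn (prim (pTilde δ η) t) (Icc (-1) 1) := continuousOn_primitive iP
  have eN := fun x hx => prim_nTilde hδ hη (x := x) hx
  have eP := fun x hx => prim_pTilde hδ hη (x := x) hx
  have N1 : ∫ x in (-1 : ℝ)..1, nTilde δ η t x = 0 := by
    have := eN 1 (by simp)
    rw [hδ1, hη1] at this
    simpa [prim] using this
  have P1 : ∫ x in (-1 : ℝ)..1, pTilde δ η t x = 0 := by
    have := eP 1 (by simp)
    rw [hδ1, hη1] at this
    simpa [prim] using this
  have uN : hMinusOneNorm (nTilde δ η t) ≤ l2Norm (prim (nTilde δ η) t) := hMinusOneNorm_le iN N1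
  have uP : hMinusOneNorm (pTilde δ η t) ≤ l2Norm (prim (pTilde δ η) t) := hMinusOneNorm_le iP P1
  have lN : l2Norm (prim (nTilde δ η) t) ≤ 3 * hMinusOneNorm (nTilde δ η t) :=
    l2Norm_primitive_le iN N1
  have lP : l2Norm (prim (pTilde δ η) t) ≤ 3 * hMinusOneNorm (pTilde δ η t) :=
    l2Norm_primitive_le iP P1
  have half : |(1 / 2 : ℝ)| = 1 / 2 := abs_of_pos (by norm_num)
  have tN : l2Norm (prim (nTilde δ η) t)
      ≤ 1 / 2 * l2Norm (prim δ t) + 1 / 2 * l2Norm (prim η t) := by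
    rw [l2Norm_congr eN]
    refine (l2Norm_add_le (continuousOn_const.fun_mul cD) (continuousOn_const.fun_mul cH)).trans ?_
    rw [l2Norm_const_mul, l2Norm_const_mul, half]
  have tP : l2Norm (prim (pTilde δ η) t)
      ≤ 1 / 2 * l2Norm (prim η t) + 1 / 2 * l2Norm (prim δ t) := by
    rw [l2Norm_congr eP]
    refine (l2Norm_add_le (continuousOn_const.fun_mul cH) (continuousOn_const.fun_mul cD)).trans ?_
    rw [l2Norm_const_mul, l2Norm_const_mul, abs_neg, half]
  have tD : l2Norm (prim δ t) ≤ l2Norm (prim (nTilde δ η) t) + l2Norm (prim (pTilde δ η) t) := by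
    have e : ∀ x ∈ Icc (-1 : ℝ) 1,
        prim δ t x = prim (nTilde δ η) t x + -1 * prim (pTilde δ η) t x := fun x hx => by
      rw [eN x hx, eP x hx]; ring
    rw [l2Norm_congr e]
    refine (l2Norm_add_le cN (continuousOn_const.fun_mul cP)).trans ?_
    rw [l2Norm_const_mul]; simp
  have tH : l2Norm (prim η t) ≤ l2Norm (prim (nTilde δ η) t) + l2Norm (prim (pTilde δ η) t) := by
    have e : ∀ x ∈ Icc (-1 : ℝ) 1,
        prim η t x = prim (nTilde δ η) t x + prim (pTilde δ η) t x := fun x hx => by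
      rw [eN x hx, eP x hx]; ring
    rw [l2Norm_congr e]
    exact l2Norm_add_le cN cP
  -- With `N`, `P` the primitives of `ñ`, `p̃`, `D = N - P` and `H = N + P` give a factor `2`, and
  -- `l2Norm_primitive_le` a factor `3`; hence `1/6`.
  refine ⟨by linarith, by linarith, ?_⟩
  -- This is the parallelogram identity for `(H + D) / 2` and `(H - D) / 2`.
  have e : l2Norm (prim (nTilde δ η) t) ^ 2 + l2Norm (prim (pTilde δ η) t) ^ 2 = energy δ η t := by
    have i : ∀ {f : ℝ → ℝ}, ContinuousOn f (Icc (-1) 1) →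
        IntervalIntegrable (fun x => f x ^ 2) volume (-1) 1 := fun hf =>
      intervalIntegrable_of_continuousOn (hf.fun_pow 2)
    rw [energy_eq hδ hη, l2Norm_sq, l2Norm_sq, ← intervalIntegral.integral_add (i cN) (i cP),
      ← intervalIntegral.integral_add (i cD) (i cH), ← intervalIntegral.integral_const_mul]
    refine intervalIntegral.integral_congr fun x hx => ?_
    rw [uIcc_of_le (by norm_num)] at hx
    simp only [eN x hx, eP x hx]
    ring
  rw [← e]
  have := hMinusOneNorm_nonneg iN N1
  have := hMinusOneNorm_nonneg iP P1
  gcongr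

end Densities

end PNP

end

theorem mainTheorem2 :
    ∃ α C₁ C₂ : ℝ, 0 < α ∧ 0 < C₁ ∧ 0 < C₂ ∧
      ∀ (m₀ φb γmax ε γ : ℝ), 0 < m₀ → 0 < φb → 0 < ε → 0 < γ → γ ≤ γmax →
        γ / Real.sqrt ε >
          ((1 + 2 * γmax) ^ 2 + 3) * PNP.constK φb * φb / (4 * PNP.constM m₀ φb) →
      ∀ ψ : ℝ → ℝ, PNP.IsBoundaryLayer ε γ m₀ φb ψ →
      ∀ δ η φ : ℝ → ℝ → ℝ, PNP.IsLinearizedSolution ε γ m₀ ψ δ η φ →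
        (∫ x in (-1 : ℝ)..1, δ 0 x) = 0 → (∫ x in (-1 : ℝ)..1, η 0 x) = 0 →
        (∀ t > 0,
          PNP.energy δ η t ≤ PNP.energy δ η 0 * Real.exp (-α * t)) ∧
        (∀ t > 0,
          (PNP.l2Norm (PNP.prim δ t)) ^ 2 + (PNP.l2Norm (PNP.prim η t)) ^ 2
            ≤ 2 * PNP.energy δ η 0 * Real.exp (-α * t)) ∧
        (∀ t ≥ 0,
          C₁ * (PNP.l2Norm (PNP.prim δ t) + PNP.l2Norm (PNP.prim η t))
              ≤ PNP.hMinusOneNorm (PNP.nTilde δ η t) + PNP.hMinusOneNorm (PNP.pTilde δ η t) ∧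
          PNP.hMinusOneNorm (PNP.nTilde δ η t) + PNP.hMinusOneNorm (PNP.pTilde δ η t)
              ≤ C₂ * (PNP.l2Norm (PNP.prim δ t) + PNP.l2Norm (PNP.prim η t))) ∧
        (∀ t > 0,
          (PNP.hMinusOneNorm (PNP.nTilde δ η t)) ^ 2 + (PNP.hMinusOneNorm (PNP.pTilde δ η t)) ^ 2
            ≤ PNP.energy δ η 0 * Real.exp (-α * t)) := by

  refine ⟨1 / 4, 1 / 6, 1, by norm_num, by norm_num, by norm_num, ?_⟩
  intro m₀ φb γmax ε γ hm hφ hε hγ hmax hcond ψ hb δ η φ h hδ0 hη0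
  have hsmall := PNP.mul_sq_lt_of_condition hm hφ hε hγ hmax hcond
  have hE : ∀ t > 0, PNP.energy δ η t ≤ PNP.energy δ η 0 * Real.exp (-(1 / 4) * t) :=
    fun t ht => h.energy_le hb hm hφ hε hγ hsmall hδ0 hη0 ht
  have hN := fun (t : ℝ) (ht : 0 ≤ t) =>
    PNP.hMinusOneNorm_densities (h.intervalIntegrable_delta ht) (h.intervalIntegrable_eta ht)
      (h.prim_delta_one hb.regular hε hγ hδ0 ht) (h.prim_eta_one hb.regular hε hγ hη0 ht)
  refine ⟨hE, fun t ht => ?_, fun t ht => ⟨(hN t ht).1, (hN t ht).2.1⟩,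
    fun t ht => (hN t (le_of_lt ht)).2.2.trans (hE t ht)⟩
  have := hE t ht
  rw [PNP.energy_eq (h.intervalIntegrable_delta (le_of_lt ht))
    (h.intervalIntegrable_eta (le_of_lt ht))] at this
  rw [PNP.l2Norm_sq, PNP.l2Norm_sq]
  linarith
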